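/- Let $\eta(\tau)=q^{1/24}\prod_{n\ge 1}(1-q^n)$, $q=e^{2\pi i\tau}$, be the Dedekind eta function, and for $\tau$ in the upper half plane put $$h_{00}(\tau)=56\,\frac{\eta(2\tau)^8}{\eta(\tau)^{16}},\qquad h_0(\tau)=-8\,\frac{\eta(2\tau)^8}{\eta(\tau)^{16}},\qquad h_1(\tau)=8\,\frac{\eta(2\tau)^8}{\eta(\tau)^{16}}+\frac{\eta(\tau/2)^8}{\eta(\tau)^{16}} .$$ (1) For all $\tau$ in the upper half plane, $$h_{00}(\tau+1)=h_{00}(\tau),\qquad h_{00}(-1/\tau)=\tfrac{\tau^{-4}}{8}\bigl(h_{00}(\tau)+35h_0(\tau)+28h_1(\tau)\bigr),$$ $$h_{0}(\tau+1)=h_{0}(\tau),\qquad h_{0}(-1/\tau)=\tfrac{\tau^{-4}}{8}\bigl(h_{00}(\tau)+3h_0(\tau)-4h_1(\tau)\bigr),$$ $$h_{1}(\tau+1)=-h_{1}(\tau),\qquad h_{1}(-1/\tau)=\tfrac{\tau^{-4}}{8}\bigl(h_{00}(\tau)-5h_0(\tau)+4h_1(\tau)\bigr).$$ (2) On the upper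 half plane there are convergent expansions $h_{00}=\sum_{n\ge0}a_nq^n$, $h_0=\sum_{n\ge0}b_nq^n$, $h_1=\sum_{n\ge0}c_nq^{n-1/2}$ (with $q^r=e^{2\pi i r\tau}$) which begin $$h_{00}=56+896q+8064q^2+\cdots,\quad h_0=-8-128q-1152q^2-\cdots,\quad h_1=q^{-1/2}+36q^{1/2}+402q^{3/2}+\cdots .$$ (3) Let $N=U\oplus U(2)\oplus D_4\oplus D_4$, where $U$ is the hyperbolic plane with Gram matrix $\begin{pmatrix}0&1\\1&0\end{pmatrix}$, $U(2)$ is $U$ with its form multiplied by $2$, and $D_4=\{x\in\mathbf Z^4: x_1+x_2+x_3+x_4\equiv 0 \bmod 2\}$ with the negative of the standard inner product. Let $A_N=N^*/N$, with the quadratic form $q_N(x)=\langle x,x\rangle \bmod 2\mathbf Z$. For $\alpha\in A_N$ let $h_\alpha$ be $h_{00}$ if $\alpha=0$, $h_0$ if $\alpha\ne0$ and $q_N(\alpha)=0$, and $h_1$ if $q_N(\alpha)\neq0$. Then for all $\alpha\in A_N$ and $\tau$ in the upper half plane $$h_\alpha(\tau+1)=e^{\pi i\,q_N(\alpha)}h_\alpha(\tau),\qquad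 h_\alpha(-1/\tau)=\frac{\tau^{-4}}{8}\sum_{\beta\in A_N}e^{-2\pi i\langle\alpha,\beta\rangle}h_\beta(\tau).$$ Moreover $h=\sum_\alpha h_\alpha e_\alpha$ is a vector-valued modular form of weight $-4$ for the Weil representation $\rho$ of $SL(2,\mathbf Z)$ on $\mathbf C[A_N]$, that is, the representation with $$\rho\begin{pmatrix}1&1\\0&1\end{pmatrix}e_\alpha=e^{\pi i\,q_N(\alpha)}e_\alpha,\qquad \rho\begin{pmatrix}0&-1\\1&0\end{pmatrix}e_\alpha=\frac18\sum_{\beta\in A_N}e^{2\pi i\langle\beta,\alpha\rangle}e_\beta :$$ each $h_\alpha$ is holomorphic on the upper half plane, and $h\bigl(\tfrac{a\tau+b}{c\tau+d}\bigr)=(c\tau+d)^{-4}\rho(\gamma)h(\tau)$ for all $\gamma=\begin{pmatrix}a&b\\c&d\end{pmatrix}\in SL(2,\mathbf Z)$. -/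

import Mathlib

noncomputable section

open Complex

namespace EightPoints

/-! ### The lattice `N = U ⊕ U(2) ⊕ D₄ ⊕ D₄` -/

/-- The rational quadratic space `N ⊗ ℚ`, one factor for each summand `U`, `U(2)`, `D₄`, `D₄`. -/
abbrev AmbientN : Type :=
  (Fin 2 → ℚ) × (Fin 2 → ℚ) × (Fin 4 → ℚ) × (Fin 4 → ℚ)

/-- The bilinear form `⟨x, y⟩`: the hyperbolic plane on the first factor, twice the
hyperbolic plane on the second, and minus the standard inner product on the last two. -/
def formN : LinearMap.BilinForm ℚ AmbientN :=
  LinearMap.mk₂ ℚ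
    (fun x y =>
      (x.1 0 * y.1 1 + x.1 1 * y.1 0)
        + 2 * (x.2.1 0 * y.2.1 1 + x.2.1 1 * y.2.1 0)
        - (∑ i, x.2.2.1 i * y.2.2.1 i)
        - (∑ i, x.2.2.2 i * y.2.2.2 i))
    (fun x x' y => by simp [Fin.sum_univ_four]; ring)
    (fun c x y => by simp [Fin.sum_univ_four]; ring)
    (fun x y y' => by simp [Fin.sum_univ_four]; ring)
    (fun c x y => by simp [Fin.sum_univ_four]; ring)

/-- The integral points `ℤ²` of `ℚ²`. -/
def intPlane : Submodule ℤ (Fin 2 → ℚ) where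
  carrier := {x | ∃ z : Fin 2 → ℤ, ∀ i, x i = z i}
  zero_mem' := ⟨0, by simp⟩
  add_mem' := by
    rintro x y ⟨z, hz⟩ ⟨w, hw⟩
    exact ⟨z + w, fun i => by simp [hz, hw]⟩
  smul_mem' := by
    rintro c x ⟨z, hz⟩
    exact ⟨c • z, fun i => by simp [hz]⟩

/-- The lattice `D₄ = {x ∈ ℤ⁴ | x₁ + x₂ + x₃ + x₄ ≡ 0 mod 2}` inside `ℚ⁴`. -/
def latticeD4 : Submodule ℤ (Fin 4 → ℚ) where
  carrier := {x | ∃ z : Fin 4 → ℤ, (∀ i, x i = z i) ∧ Even (∑ i, z i)}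
  zero_mem' := ⟨0, by simp⟩
  add_mem' := by
    rintro x y ⟨z, hz, hz'⟩ ⟨w, hw, hw'⟩
    exact ⟨z + w, fun i => by simp [hz, hw], by
      simpa [Finset.sum_add_distrib] using hz'.add hw'⟩
  smul_mem' := by
    rintro c x ⟨z, hz, hz'⟩
    exact ⟨c • z, fun i => by simp [hz], by
      simpa [← Finset.mul_sum] using hz'.mul_left c⟩

/-- The lattice `N = U ⊕ U(2) ⊕ D₄ ⊕ D₄`. -/
def latticeN : Submodule ℤ AmbientN :=
  intPlane.prod (intPlane.prod (latticeD4.prod latticeD4))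

/-- The dual lattice `N* = {x ∈ N ⊗ ℚ | ⟨x, y⟩ ∈ ℤ for all y ∈ N}`. -/
def dualN : Submodule ℤ AmbientN := formN.dualSubmodule latticeN

/-- The discriminant group `A_N = N*/N`. -/
abbrev DiscN : Type := dualN ⧸ latticeN.submoduleOf dualN

theorem formN_comm (x y : AmbientN) : formN x y = formN y x := by
  simp [formN, Fin.sum_univ_four]; ring

theorem formN_even {x : AmbientN} (hx : x ∈ latticeN) : ∃ m : ℤ, formN x x = 2 * m := by
  obtain ⟨⟨a, ha⟩, ⟨b, hb⟩, ⟨c, hc, ⟨s, hs⟩⟩, ⟨d, hd, ⟨t, ht⟩⟩⟩ := hx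
  have key : ∀ z : ℤ, ∃ w, z * z = z + 2 * w := fun z => by
    obtain ⟨w, hw⟩ := Int.even_mul_pred_self z
    exact ⟨w, by linarith⟩
  choose w hw using key
  have hw' : ∀ z : ℤ, (z : ℚ) * z = z + 2 * w z := fun z => by exact_mod_cast hw z
  rw [Fin.sum_univ_four] at hs ht
  have hs' : (c 0 + c 1 + c 2 + c 3 : ℚ) = s + s := by exact_mod_cast hs
  have ht' : (d 0 + d 1 + d 2 + d 3 : ℚ) = t + t := by exact_mod_cast ht
  refine ⟨a 0 * a 1 + 2 * (b 0 * b 1)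
    - (s + w (c 0) + w (c 1) + w (c 2) + w (c 3))
    - (t + w (d 0) + w (d 1) + w (d 2) + w (d 3)), ?_⟩
  simp only [formN, LinearMap.mk₂_apply, Fin.sum_univ_four, ha, hb, hc, hd, hw']
  push_cast
  linear_combination -hs' - ht'

theorem formN_dual {x y : AmbientN} (hx : x ∈ dualN) (hy : y ∈ latticeN) :
    ∃ m : ℤ, formN x y = m := by
  obtain ⟨m, hm⟩ := Submodule.mem_one.mp (hx y hy)
  exact ⟨m, by simpa using hm.symm⟩

theorem formN_self_congr {x x' : dualN} (h : (x - x' : dualN) ∈ latticeN.submoduleOf dualN) :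
    ∃ m : ℤ, formN (x : AmbientN) x = formN (x' : AmbientN) x' + 2 * m := by
  have h' : ((x : AmbientN) - x') ∈ latticeN := h
  obtain ⟨m, hm⟩ := formN_even h'
  obtain ⟨n, hn⟩ := formN_dual x'.2 h'
  refine ⟨m + n, ?_⟩
  simp only [map_sub, LinearMap.sub_apply] at hm hn
  rw [formN_comm x x'] at hm
  push_cast
  linarith

theorem formN_congr {x x' y y' : dualN} (hx : (x - x' : dualN) ∈ latticeN.submoduleOf dualN)
    (hy : (y - y' : dualN) ∈ latticeN.submoduleOf dualN) :
    ∃ m : ℤ, formN (x : AmbientN) y = formN (x' : AmbientN) y' + m := by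
  have hx' : ((x : AmbientN) - x') ∈ latticeN := hx
  have hy' : ((y : AmbientN) - y') ∈ latticeN := hy
  obtain ⟨m, hm⟩ := formN_dual y.2 hx'
  obtain ⟨n, hn⟩ := formN_dual x'.2 hy'
  refine ⟨m + n, ?_⟩
  rw [formN_comm] at hm
  simp only [map_sub, LinearMap.sub_apply] at hm hn
  push_cast
  linarith

/-- The discriminant quadratic form `q_N : A_N → ℚ/2ℤ`, `q_N(x) = ⟨x, x⟩ mod 2ℤ`. -/
def qN (α : DiscN) : AddCircle (2 : ℚ) :=
  Quotient.liftOn' α (fun x => ((formN (x : AmbientN) x : ℚ) : AddCircle (2 : ℚ))) <| by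
    intro x x' h
    obtain ⟨m, hm⟩ := formN_self_congr ((Submodule.quotientRel_def _).mp h)
    refine (QuotientAddGroup.eq_iff_sub_mem).mpr (AddSubgroup.mem_zmultiples_iff.mpr ⟨m, ?_⟩)
    rw [hm, zsmul_eq_mul]
    ring

/-- The pairing `⟨α, β⟩ ∈ ℚ/ℤ` on `A_N` induced by the bilinear form. -/
def pairN (α β : DiscN) : AddCircle (1 : ℚ) :=
  Quotient.liftOn₂' α β (fun x y => ((formN (x : AmbientN) y : ℚ) : AddCircle (1 : ℚ))) <| by
    intro x y x' y' hx hy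
    obtain ⟨m, hm⟩ := formN_congr ((Submodule.quotientRel_def _).mp hx)
      ((Submodule.quotientRel_def _).mp hy)
    refine (QuotientAddGroup.eq_iff_sub_mem).mpr (AddSubgroup.mem_zmultiples_iff.mpr ⟨m, ?_⟩)
    rw [hm, zsmul_eq_mul]
    ring

theorem qN_mk (x : dualN) :
    qN (Submodule.Quotient.mk x) = ((formN (x : AmbientN) x : ℚ) : AddCircle (2 : ℚ)) := rfl

theorem pairN_mk (x y : dualN) : pairN (Submodule.Quotient.mk x) (Submodule.Quotient.mk y) =
    ((formN (x : AmbientN) y : ℚ) : AddCircle (1 : ℚ)) := rfl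

theorem half_integral {x : AmbientN} (hx : x ∈ dualN) :
    (∀ i, ∃ z : ℤ, 2 * x.1 i = z) ∧ (∀ i, ∃ z : ℤ, 2 * x.2.1 i = z) ∧
    (∀ i, ∃ z : ℤ, 2 * x.2.2.1 i = z) ∧ (∀ i, ∃ z : ℤ, 2 * x.2.2.2 i = z) := by
  have hP : ∀ i : Fin 2, (Pi.single i 1 : Fin 2 → ℚ) ∈ intPlane := fun i =>
    ⟨Pi.single i 1, fun j => by by_cases h : j = i <;> simp [h]⟩
  have hD : ∀ i : Fin 4, (Pi.single i 2 : Fin 4 → ℚ) ∈ latticeD4 := fun i =>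
    ⟨Pi.single i 2, fun j => by by_cases h : j = i <;> simp [h], by simp⟩
  have h1 : ∀ i, ∃ z : ℤ, formN x (Pi.single i 1, 0, 0, 0) = z := fun i =>
    formN_dual hx ⟨hP i, zero_mem _, zero_mem _, zero_mem _⟩
  have h2 : ∀ i, ∃ z : ℤ, formN x (0, Pi.single i 1, 0, 0) = z := fun i =>
    formN_dual hx ⟨zero_mem _, hP i, zero_mem _, zero_mem _⟩
  have h3 : ∀ i, ∃ z : ℤ, formN x (0, 0, Pi.single i 2, 0) = z := fun i =>
    formN_dual hx ⟨zero_mem _, zero_mem _, hD i, zero_mem _⟩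
  have h4 : ∀ i, ∃ z : ℤ, formN x (0, 0, 0, Pi.single i 2) = z := fun i =>
    formN_dual hx ⟨zero_mem _, zero_mem _, zero_mem _, hD i⟩
  simp only [formN, LinearMap.mk₂_apply, Pi.single_apply] at h1 h2 h3 h4
  refine ⟨fun i => ?_, fun i => ?_, fun i => ?_, fun i => ?_⟩
  · obtain ⟨z, hz⟩ := h1 (1 - i)
    exact ⟨2 * z, by fin_cases i <;> simp at hz ⊢ <;> linarith⟩
  · obtain ⟨z, hz⟩ := h2 (1 - i)
    exact ⟨z, by fin_cases i <;> simp at hz ⊢ <;> linarith⟩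
  · obtain ⟨z, hz⟩ := h3 i
    exact ⟨-z, by simp at hz ⊢; linarith⟩
  · obtain ⟨z, hz⟩ := h4 i
    exact ⟨-z, by simp at hz ⊢; linarith⟩

theorem sub_eq_of_residue {r s : ℚ} (hr : ∃ z : ℤ, 2 * r = z) (hs : ∃ z : ℤ, 2 * s = z)
    (h : ((⌊2 * r⌋ : ℤ) : ZMod 4) = ((⌊2 * s⌋ : ℤ) : ZMod 4)) :
    ∃ w : ℤ, r - s = 2 * w := by
  obtain ⟨z, hz⟩ := hr
  obtain ⟨z', hz'⟩ := hs
  rw [hz, hz', Int.floor_intCast, Int.floor_intCast, ZMod.intCast_eq_intCast_iff_dvd_sub] at h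
  obtain ⟨w, hw⟩ := h
  have hw' : (z' : ℚ) - z = 4 * w := by exact_mod_cast hw
  exact ⟨-w, by push_cast; linarith⟩

/-- `A_N` is finite: twice an element of `N*` is integral, and its residues modulo `4`
determine its class. -/
instance finite_discN : Finite DiscN := by
  let f : DiscN → (Fin 2 → ZMod 4) × (Fin 2 → ZMod 4) × (Fin 4 → ZMod 4) × (Fin 4 → ZMod 4) :=
    fun α =>
      let x : AmbientN := (Quotient.out α : dualN)
      (fun i => (⌊2 * x.1 i⌋ : ℤ), fun i => (⌊2 * x.2.1 i⌋ : ℤ),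
        fun i => (⌊2 * x.2.2.1 i⌋ : ℤ), fun i => (⌊2 * x.2.2.2 i⌋ : ℤ))
  refine Finite.of_injective f fun α β h => ?_
  rw [← Quotient.out_eq α, ← Quotient.out_eq β]
  refine (Submodule.Quotient.eq _).mpr ?_
  obtain ⟨a1, a2, a3, a4⟩ := half_integral (Quotient.out α : dualN).2
  obtain ⟨b1, b2, b3, b4⟩ := half_integral (Quotient.out β : dualN).2
  simp only [f, Prod.mk.injEq, funext_iff] at h
  obtain ⟨e1, e2, e3, e4⟩ := h
  choose w1 hw1 using fun i => sub_eq_of_residue (a1 i) (b1 i) (e1 i)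
  choose w2 hw2 using fun i => sub_eq_of_residue (a2 i) (b2 i) (e2 i)
  choose w3 hw3 using fun i => sub_eq_of_residue (a3 i) (b3 i) (e3 i)
  choose w4 hw4 using fun i => sub_eq_of_residue (a4 i) (b4 i) (e4 i)
  refine ⟨⟨fun i => 2 * w1 i, fun i => ?_⟩, ⟨fun i => 2 * w2 i, fun i => ?_⟩,
    ⟨fun i => 2 * w3 i, fun i => ?_, ?_⟩, ⟨fun i => 2 * w4 i, fun i => ?_, ?_⟩⟩
  · push_cast; exact hw1 i
  · push_cast; exact hw2 i
  · push_cast; exact hw3 i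
  · rw [← Finset.mul_sum]; exact even_two_mul _
  · push_cast; exact hw4 i
  · rw [← Finset.mul_sum]; exact even_two_mul _

instance fintypeDiscN : Fintype DiscN := Fintype.ofFinite DiscN

/-! ### The Weil representation -/

/-- The character `x ↦ e^{πix}` of `ℚ/2ℤ`; on the classes of integers it is `(-1)^x`. -/
def expPi : AddCircle (2 : ℚ) → ℂ :=
  Function.Periodic.lift (f := fun x : ℚ => exp (Real.pi * I * x)) (c := 2) <| fun x => by
    push_cast
    rw [mul_add, exp_add, show (Real.pi : ℂ) * I * 2 = 2 * Real.pi * I by ring,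
      exp_two_pi_mul_I, mul_one]

/-- The character `x ↦ e^{2πix}` of `ℚ/ℤ`. -/
def expTwoPi : AddCircle (1 : ℚ) → ℂ :=
  Function.Periodic.lift (f := fun x : ℚ => exp (2 * Real.pi * I * x)) (c := 1) <| fun x => by
    push_cast
    rw [mul_add, exp_add, mul_one (2 * (Real.pi : ℂ) * I), exp_two_pi_mul_I, mul_one]

/-- The basis vector `e_α` of `ℂ[A_N]`, realised as the space of functions `A_N → ℂ`. -/
def basisVec (α : DiscN) : DiscN → ℂ := by
  classical exact Pi.single α 1

/-- `ρ` is the Weil representation of `SL(2, ℤ)` on `ℂ[A_N]`: on the generators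
`T = (1 1; 0 1)` and `S = (0 -1; 1 0)` it is given by `ρ(T) e_α = (-1)^{q_N(α)} e_α` and
`ρ(S) e_α = (1/8) ∑_β (-1)^{b_N(β, α)} e_β`, where `b_N = 2⟨·, ·⟩`,
so that `(-1)^{b_N(β, α)} = e^{2πi⟨β, α⟩}`. -/
structure IsWeilRepresentation
    (ρ : Representation ℂ (Matrix.SpecialLinearGroup (Fin 2) ℤ) (DiscN → ℂ)) : Prop where
  map_T : ∀ α, ρ ModularGroup.T (basisVec α) = expPi (qN α) • basisVec α
  map_S : ∀ α, ρ ModularGroup.S (basisVec α) =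
    (1 / 8 : ℂ) • ∑ β, expTwoPi (pairN β α) • basisVec β

/-- `F = ∑_α F_α e_α` is a vector-valued modular form of weight `k` and type `ρ`: its components
are holomorphic on the upper half plane, and
`F((aτ + b)/(cτ + d)) = (cτ + d)^k ρ(γ) F(τ)` for `γ = (a b; c d)` in `SL(2, ℤ)`. -/
structure IsVectorValuedModularForm (k : ℤ)
    (ρ : Representation ℂ (Matrix.SpecialLinearGroup (Fin 2) ℤ) (DiscN → ℂ))
    (F : ℂ → DiscN → ℂ) : Prop where
  holo : ∀ α, DifferentiableOn ℂ (fun τ => F τ α) {τ : ℂ | 0 < τ.im}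
  modular : ∀ (γ : Matrix.SpecialLinearGroup (Fin 2) ℤ) (τ : ℂ), 0 < τ.im →
    F (((γ 0 0 : ℤ) * τ + (γ 0 1 : ℤ)) / ((γ 1 0 : ℤ) * τ + (γ 1 1 : ℤ))) =
      (((γ 1 0 : ℤ) : ℂ) * τ + (γ 1 1 : ℤ)) ^ k • ρ γ (F τ)

/-- The transformation equations of weight `-4` for the generators `τ ↦ τ + 1` and `τ ↦ -1/τ`:
`f_α(τ + 1) = e^{πi q_N(α)} f_α(τ)` and
`f_α(-1/τ) = (τ^{-4}/8) ∑_β e^{-2πi⟨α, β⟩} f_β(τ)`. -/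
structure SatisfiesGeneratorEquations (F : ℂ → DiscN → ℂ) : Prop where
  eq_T : ∀ (α : DiscN) (τ : ℂ), 0 < τ.im → F (τ + 1) α = expPi (qN α) * F τ α
  eq_S : ∀ (α : DiscN) (τ : ℂ), 0 < τ.im →
    F (-1 / τ) α = τ ^ (-4 : ℤ) / 8 * ∑ β, expTwoPi (-pairN α β) * F τ β

/-- The family `(f_α)` whose components depend only on the type of `α`: `f₀₀` for `α = 0`,
`f₀` for `α ≠ 0` isotropic and `f₁` for `α` non-isotropic. -/
def byType (f00 f0 f1 : ℂ → ℂ) (τ : ℂ) (α : DiscN) : ℂ := by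
  classical exact if α = 0 then f00 τ else if qN α = 0 then f0 τ else f1 τ

/-- The transformation equations for the three functions `f₀₀`, `f₀`, `f₁`. -/
structure SolvesTransformationEquations (f00 f0 f1 : ℂ → ℂ) : Prop where
  f00_T : ∀ τ : ℂ, 0 < τ.im → f00 (τ + 1) = f00 τ
  f00_S : ∀ τ : ℂ, 0 < τ.im →
    f00 (-1 / τ) = τ ^ (-4 : ℤ) / 8 * (f00 τ + 35 * f0 τ + 28 * f1 τ)
  f0_T : ∀ τ : ℂ, 0 < τ.im → f0 (τ + 1) = f0 τ
  f0_S : ∀ τ : ℂ, 0 < τ.im →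
    f0 (-1 / τ) = τ ^ (-4 : ℤ) / 8 * (f00 τ + 3 * f0 τ - 4 * f1 τ)
  f1_T : ∀ τ : ℂ, 0 < τ.im → f1 (τ + 1) = -f1 τ
  f1_S : ∀ τ : ℂ, 0 < τ.im →
    f1 (-1 / τ) = τ ^ (-4 : ℤ) / 8 * (f00 τ - 5 * f0 τ + 4 * f1 τ)

/-! ### The eta quotients -/

/-- `h₀₀(τ) = 56 η(2τ)⁸ / η(τ)¹⁶`. -/
def h00 (τ : ℂ) : ℂ := 56 * ModularForm.eta (2 * τ) ^ 8 / ModularForm.eta τ ^ 16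

/-- `h₀(τ) = -8 η(2τ)⁸ / η(τ)¹⁶`. -/
def h0 (τ : ℂ) : ℂ := -8 * ModularForm.eta (2 * τ) ^ 8 / ModularForm.eta τ ^ 16

/-- `h₁(τ) = 8 η(2τ)⁸ / η(τ)¹⁶ + η(τ/2)⁸ / η(τ)¹⁶`. -/
def h1 (τ : ℂ) : ℂ :=
  8 * ModularForm.eta (2 * τ) ^ 8 / ModularForm.eta τ ^ 16
    + ModularForm.eta (τ / 2) ^ 8 / ModularForm.eta τ ^ 16

/-- On the upper half plane, `f(τ) = ∑_{n ≥ 0} a_n q^{n + s}` with `q^r = e^{2πirτ}`. -/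
def HasQExpansion (f : ℂ → ℂ) (s : ℂ) (a : ℕ → ℂ) : Prop :=
  ∀ τ : ℂ, 0 < τ.im → HasSum (fun n : ℕ => a n * exp (2 * Real.pi * I * (n + s) * τ)) (f τ)

end EightPoints

end

namespace EightPoints

open Complex Filter Topology
open UpperHalfPlane hiding I

/-! ### The Dedekind eta function -/

/-! The eighth power of `η` has multipliers that are only cube roots of unity: with `ω = e^{2πi/3}`,
`τ ↦ τ + 1` multiplies `η⁸` by `ω`, and `τ ↦ -1/τ` multiplies it by `τ⁴`. Hence `-1/τ` exchanges
`η(2τ)⁸/η(τ)¹⁶` and `η(τ/2)⁸/η(τ)¹⁶` up to explicit factors, and all transformation equations but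
one are linear algebra.

The exception, `h1 (τ + 1) = -h1 τ`, is equivalent to Jacobi's identity `η(τ/2)⁸ + ω η((τ+1)/2)⁸ +
16 η(2τ)⁸ = 0`. The left side `J` has weight 4 for the full modular group up to cube roots of unity,
so `J³/η²⁴` is invariant of weight 0. It tends to 0 at infinity, hence is a constant equal to 0
(`jacobiDefect_eq_zero`). The same identity makes `q^{1/2} h1` even in `q^{1/2}`, which gives its
expansion in powers `q^{n - 1/2}`; leading coefficients come from the Euler product modulo `x⁵`.

On the lattice side, `A_N` is 2-elementary of order 64 and `q_N` is integer valued, so `chi = e^{πi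
q_N}` and its polarization `bichar` are signs. A vector depending only on the type of `α` is a
combination of `δ₀`, `1` and `chi` (`byType_eq`). Their Fourier transforms are `1`, `64 δ₀` and `8
chi`, by nondegeneracy and the Gauss sum 8 (`sum_chi`, `sum_bichar_mul_chi`). So the equations for
three functions imply those for 64 components.

The same facts show that the operators of `S` and `T` are involutions satisfying the braid relation.
They therefore define a representation through `SL(2, 𝔽₂) ≅ S₃`, and modularity spreads from the
generators by the cocycle relation. -/

/-- The Euler product `∏_{n ≥ 1} (1 - xⁿ)`. -/
noncomputable def eulerProd (x : ℂ) : ℂ := ∏' n : ℕ, (1 - x ^ (n + 1))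

theorem eulerProd_zero : eulerProd 0 = 1 := by simp [eulerProd]

theorem differentiableOn_eulerProd : DifferentiableOn ℂ eulerProd (Metric.ball 0 1) :=
  ModularForm.differentiableOn_tprod_one_sub_pow

theorem eulerProd_ne_zero {x : ℂ} (hx : ‖x‖ < 1) : eulerProd x ≠ 0 := by
  have h : ∏' n : ℕ, (1 + -x ^ (n + 1)) ≠ 0 := by
    refine tprod_one_add_ne_zero_of_summable (f := fun n => -x ^ (n + 1)) (fun n h => ?_) ?_
    · have h1 : x ^ (n + 1) = 1 := by linear_combination -h
      have h2 := congrArg norm h1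
      rw [norm_pow, norm_one] at h2
      exact (pow_lt_one₀ (norm_nonneg x) hx n.succ_ne_zero).ne h2
    · simpa using (summable_nat_add_iff 1).mpr (summable_geometric_of_lt_one (norm_nonneg _) hx)
  simpa [eulerProd, sub_eq_add_neg] using h

theorem eta_pow_eight (τ : ℂ) : ModularForm.eta τ ^ 8 =
    exp (2 * Real.pi * I * τ / 3) * eulerProd (exp (2 * Real.pi * I * τ)) ^ 8 := by
  rw [ModularForm.eta, mul_pow, Function.Periodic.qParam, ← exp_nat_mul]
  simp only [ModularForm.eta_q_eq_pow, eulerProd]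
  congr 2
  push_cast
  ring

theorem norm_exp_lt_one {τ : ℂ} (hτ : 0 < τ.im) : ‖exp (2 * Real.pi * I * τ)‖ < 1 :=
  norm_exp_two_pi_I_lt_one ⟨τ, hτ⟩

theorem norm_exp_pi_lt_one {τ : ℂ} (hτ : 0 < τ.im) : ‖exp (Real.pi * I * τ)‖ < 1 := by
  rw [norm_exp, Real.exp_lt_one_iff]
  simpa using mul_pos Real.pi_pos hτ

theorem neg_one_div_im_pos {τ : ℂ} (hτ : 0 < τ.im) : 0 < (-1 / τ).im := by
  have h0 : τ ≠ 0 := fun h => by simp [h] at hτ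
  rw [neg_div, one_div, neg_im, inv_im]
  have := normSq_pos.mpr h0
  rw [neg_div, neg_neg]
  positivity

theorem eta_pow_eight_add_one (τ : ℂ) : ModularForm.eta (τ + 1) ^ 8 =
    exp (2 * Real.pi * I / 3) * ModularForm.eta τ ^ 8 := by
  rw [eta_pow_eight, eta_pow_eight, ← mul_assoc, ← exp_add]
  congr 3
  · ring
  · rw [mul_add, exp_add, mul_one, exp_two_pi_mul_I, mul_one]

/-- The branch of the square root in the transformation law of `η` disappears in the eighth power.
-/
theorem sqrt_pow_eight (z : ℂ) : sqrt z ^ 8 = z ^ 4 := by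
  rw [Complex.sqrt, ← cpow_nat_mul]
  norm_num

theorem eta_pow_eight_neg_one_div {τ : ℂ} (hτ : 0 < τ.im) : ModularForm.eta (-1 / τ) ^ 8 =
    τ ^ 4 * ModularForm.eta τ ^ 8 := by
  have h := ModularForm.eta_comp_eq_csqrt_I_inv (x := τ) hτ
  simp only [Function.comp_apply, Pi.smul_apply, Pi.mul_apply, smul_eq_mul] at h
  rw [h, mul_pow, mul_pow, inv_pow, sqrt_pow_eight, sqrt_pow_eight, I_pow_four]
  ring

theorem eta_ne_zero {τ : ℂ} (hτ : 0 < τ.im) : ModularForm.eta τ ≠ 0 :=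
  ModularForm.eta_ne_zero hτ

theorem differentiableOn_eta :
    DifferentiableOn ℂ ModularForm.eta {τ : ℂ | 0 < τ.im} := fun _ hτ =>
  (ModularForm.differentiableAt_eta_of_mem_upperHalfPlaneSet hτ).differentiableWithinAt

theorem differentiableOn_eta_two_mul :
    DifferentiableOn ℂ (fun τ => ModularForm.eta (2 * τ)) {τ : ℂ | 0 < τ.im} :=
  differentiableOn_eta.comp (by fun_prop) fun τ (hτ : 0 < τ.im) => by simpa using hτ

theorem differentiableOn_eta_div_two :
    DifferentiableOn ℂ (fun τ => ModularForm.eta (τ / 2)) {τ : ℂ | 0 < τ.im} :=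
  differentiableOn_eta.comp (by fun_prop) fun τ (hτ : 0 < τ.im) => by simpa using hτ

theorem differentiableOn_eta_add_one_div_two :
    DifferentiableOn ℂ (fun τ => ModularForm.eta ((τ + 1) / 2)) {τ : ℂ | 0 < τ.im} :=
  differentiableOn_eta.comp (by fun_prop) fun τ (hτ : 0 < τ.im) => by simpa using hτ

theorem exp_two_pi_div_three_pow : exp (2 * Real.pi * I / 3) ^ 3 = 1 := by
  rw [← exp_nat_mul]
  convert exp_two_pi_mul_I using 2
  push_cast
  ring

/-- With `τ = 2u + 1` the argument becomes `u/(2u + 1)`, the image of `u` under `S T⁻² S`. The two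
translations contribute `ω⁻² = ω`, which is the factor turning `η(u)⁸` into `η(u + 1)⁸`. -/
theorem eta_pow_eight_add_one_div_two_neg_one_div {τ : ℂ} (hτ : 0 < τ.im) :
    ModularForm.eta ((-1 / τ + 1) / 2) ^ 8 = τ ^ 4 * ModularForm.eta ((τ + 1) / 2) ^ 8 := by
  have h0 : τ ≠ 0 := fun h => by simp [h] at hτ
  have hw := exp_two_pi_div_three_pow
  set w := exp (2 * Real.pi * I / 3) with hwd
  have hw0 : w ≠ 0 := exp_ne_zero _
  obtain ⟨u, rfl⟩ : ∃ u, τ = 2 * u + 1 := ⟨(τ - 1) / 2, by ring⟩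
  have hu : 0 < u.im := by simpa using hτ
  have hu0 : u ≠ 0 := fun h => by simp [h] at hu
  have hv : 0 < (-1 / u - 2).im := by simpa using neg_one_div_im_pos hu
  have hv0 : -1 / u - 2 ≠ 0 := fun h => by simp [h] at hv
  have e1 : (-1 / (2 * u + 1) + 1) / 2 = -1 / (-1 / u - 2) := by
    have : -1 / u - 2 = -(2 * u + 1) / u := by field_simp; ring
    rw [this]
    field_simp
    ring
  have e2 : (2 * u + 1 + 1) / 2 = u + 1 := by ring
  have e3 : ModularForm.eta (-1 / u) ^ 8 = w * (w * ModularForm.eta (-1 / u - 2) ^ 8) := by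
    rw [hwd, ← eta_pow_eight_add_one, ← eta_pow_eight_add_one]
    congr 2
    ring
  rw [e1, e2, eta_pow_eight_neg_one_div hv, eta_pow_eight_add_one, ← hwd]
  rw [eta_pow_eight_neg_one_div hu] at e3
  have e4 : (-1 / u - 2) ^ 4 * u ^ 4 = (2 * u + 1) ^ 4 := by
    field_simp
    ring
  have e5 : ModularForm.eta (-1 / u - 2) ^ 8 = w * (u ^ 4 * ModularForm.eta u ^ 8) := by
    linear_combination (-w) * e3 - ModularForm.eta (-1 / u - 2) ^ 8 * hw
  rw [e5, ← e4]
  ring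

/-! ### The Jacobi identity -/

/-- The weight 4 form whose vanishing is the Jacobi identity. -/
noncomputable def jacobiDefect (τ : ℂ) : ℂ :=
  ModularForm.eta (τ / 2) ^ 8 + exp (2 * Real.pi * I / 3) * ModularForm.eta ((τ + 1) / 2) ^ 8
    + 16 * ModularForm.eta (2 * τ) ^ 8

theorem jacobiDefect_add_one (τ : ℂ) :
    jacobiDefect (τ + 1) = exp (2 * Real.pi * I / 3) ^ 2 * jacobiDefect τ := by
  have hw := exp_two_pi_div_three_pow
  have e1 : (τ + 1 + 1) / 2 = τ / 2 + 1 := by ring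
  have e2 : 2 * (τ + 1) = 2 * τ + 1 + 1 := by ring
  rw [jacobiDefect, jacobiDefect, e1, e2, eta_pow_eight_add_one, eta_pow_eight_add_one,
    eta_pow_eight_add_one]
  linear_combination (-ModularForm.eta ((τ + 1) / 2) ^ 8) * hw

theorem eta_two_mul_neg_one_div {τ : ℂ} (hτ : 0 < τ.im) :
    ModularForm.eta (2 * (-1 / τ)) ^ 8 = τ ^ 4 / 16 * ModularForm.eta (τ / 2) ^ 8 := by
  have e : 2 * (-1 / τ) = -1 / (τ / 2) := by
    have h0 : τ ≠ 0 := fun h => by simp [h] at hτ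
    field_simp
  rw [e, eta_pow_eight_neg_one_div (by simpa using hτ)]
  ring

theorem eta_div_two_neg_one_div {τ : ℂ} (hτ : 0 < τ.im) :
    ModularForm.eta (-1 / τ / 2) ^ 8 = 16 * τ ^ 4 * ModularForm.eta (2 * τ) ^ 8 := by
  have e : -1 / τ / 2 = -1 / (2 * τ) := by
    have h0 : τ ≠ 0 := fun h => by simp [h] at hτ
    field_simp
  rw [e, eta_pow_eight_neg_one_div (by simpa using hτ)]
  ring

/-- `S` exchanges the outer terms and preserves the middle one; the coefficient 16 is what balances
the exchange. -/
theorem jacobiDefect_neg_one_div {τ : ℂ} (hτ : 0 < τ.im) :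
    jacobiDefect (-1 / τ) = τ ^ 4 * jacobiDefect τ := by
  rw [jacobiDefect, jacobiDefect, eta_two_mul_neg_one_div hτ, eta_div_two_neg_one_div hτ,
    eta_pow_eight_add_one_div_two_neg_one_div hτ]
  ring

/-- The function `((A(x)⁸ - A(-x)⁸) + 16 x A(x⁴)⁸)`, where `A` is the Euler product. -/
noncomputable def eulerDefect (x : ℂ) : ℂ :=
  eulerProd x ^ 8 - eulerProd (-x) ^ 8 + 16 * x * eulerProd (x ^ 4) ^ 8

/-- In terms of `x = e^{πiτ}` all three terms share the factor `x^{1/3}`. Translating `τ` by 1 turns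
`x` into `-x`, and `ω e^{πi/3} = -1` gives the minus sign. -/
theorem jacobiDefect_eq (τ : ℂ) : jacobiDefect τ =
    exp (Real.pi * I * τ / 3) * eulerDefect (exp (Real.pi * I * τ)) := by
  have a1 : exp (2 * Real.pi * I * (τ / 2)) = exp (Real.pi * I * τ) := by congr 1; ring
  have a2 : exp (2 * Real.pi * I * ((τ + 1) / 2)) = -exp (Real.pi * I * τ) := by
    rw [show 2 * Real.pi * I * ((τ + 1) / 2) = Real.pi * I * τ + Real.pi * I by ring, exp_add,
      exp_pi_mul_I, mul_neg_one]
  have a3 : exp (2 * Real.pi * I * (2 * τ)) = exp (Real.pi * I * τ) ^ 4 := by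
    rw [← exp_nat_mul]; congr 1; push_cast; ring
  have b1 : exp (2 * Real.pi * I * (τ / 2) / 3) = exp (Real.pi * I * τ / 3) := by congr 1; ring
  have b2 : exp (2 * Real.pi * I / 3) * exp (2 * Real.pi * I * ((τ + 1) / 2) / 3) =
      -exp (Real.pi * I * τ / 3) := by
    rw [← exp_add, show 2 * Real.pi * I / 3 + 2 * Real.pi * I * ((τ + 1) / 2) / 3 =
      Real.pi * I * τ / 3 + Real.pi * I by ring, exp_add, exp_pi_mul_I, mul_neg_one]
  have b3 : exp (2 * Real.pi * I * (2 * τ) / 3) =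
      exp (Real.pi * I * τ / 3) * exp (Real.pi * I * τ) := by
    rw [← exp_add]; congr 1; ring
  rw [jacobiDefect, eta_pow_eight, eta_pow_eight, eta_pow_eight, a1, a2, a3, b1, b3, ← mul_assoc,
    b2, eulerDefect]
  ring

end EightPoints

namespace EightPoints

open Complex Filter Topology MatrixGroups ModularForm
open UpperHalfPlane hiding I

/-! ### Proof of the Jacobi identity by a modular form of weight 0 -/

theorem differentiableOn_eulerProd_pow {k : ℕ} (hk : k ≠ 0) :
    DifferentiableOn ℂ (fun x => eulerProd (x ^ k)) (Metric.ball 0 1) :=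
  differentiableOn_eulerProd.comp (by fun_prop) fun x hx => by
    simp only [Metric.mem_ball, dist_zero_right, norm_pow] at hx ⊢
    exact pow_lt_one₀ (norm_nonneg x) hx hk

theorem differentiableOn_eulerProd_neg :
    DifferentiableOn ℂ (fun x => eulerProd (-x)) (Metric.ball 0 1) :=
  differentiableOn_eulerProd.comp (by fun_prop) fun x hx => by simpa using hx

theorem differentiableOn_eulerDefect : DifferentiableOn ℂ eulerDefect (Metric.ball 0 1) :=
  ((differentiableOn_eulerProd.pow 8).sub (differentiableOn_eulerProd_neg.pow 8)).add
    (DifferentiableOn.mul (by fun_prop) ((differentiableOn_eulerProd_pow four_ne_zero).pow 8))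

theorem eulerDefect_zero : eulerDefect 0 = 0 := by simp [eulerDefect]

theorem unitBall_mem_nhds : Metric.ball (0 : ℂ) 1 ∈ 𝓝 0 := Metric.ball_mem_nhds 0 one_pos

/-- The quotient of the cube of the Jacobi defect by `η²⁴`, of weight `0`. -/
noncomputable def jacobiQuotient (τ : ℍ) : ℂ := jacobiDefect τ ^ 3 / ModularForm.eta τ ^ 24

theorem jacobiQuotient_eq (τ : ℍ) : jacobiQuotient τ =
    (fun x => eulerDefect x ^ 3 / (x * eulerProd (x ^ 2) ^ 24)) (Function.Periodic.qParam 2 τ) := by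
  have hq : Function.Periodic.qParam 2 τ = exp (Real.pi * I * τ) := by
    rw [Function.Periodic.qParam]; congr 1; push_cast; ring
  have e1 : exp (2 * Real.pi * I * τ) = exp (Real.pi * I * τ) ^ 2 := by
    rw [← exp_nat_mul]; congr 1; push_cast; ring
  have e2 : exp (Real.pi * I * τ / 3) ^ 3 = exp (Real.pi * I * τ) := by
    rw [← exp_nat_mul]; congr 1; push_cast; ring
  have e3 : exp (2 * Real.pi * I * τ / 3) ^ 3 = exp (Real.pi * I * τ) ^ 2 := by
    rw [← exp_nat_mul, ← exp_nat_mul]; congr 1; push_cast; ring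
  have e4 : ModularForm.eta τ ^ 24 =
      exp (Real.pi * I * τ) ^ 2 * eulerProd (exp (Real.pi * I * τ) ^ 2) ^ 24 := by
    rw [show 24 = 8 * 3 by rfl, pow_mul, eta_pow_eight, mul_pow, e3, e1, ← pow_mul]
  have h0 : exp (Real.pi * I * τ) ≠ 0 := exp_ne_zero _
  rw [jacobiQuotient, hq, jacobiDefect_eq, mul_pow, e2, e4]
  generalize exp (Real.pi * I * τ) = x at h0 ⊢
  rw [show x ^ 2 * eulerProd (x ^ 2) ^ 24 = x * (x * eulerProd (x ^ 2) ^ 24) by ring,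
    mul_div_mul_left _ _ h0]

/-- Since `eulerDefect` vanishes at 0, its cube is divisible by `x³`, against a single `x` in the
denominator. -/
theorem tendsto_jacobiQuotient : Tendsto jacobiQuotient atImInfty (𝓝 0) := by
  have h : Tendsto (fun x => eulerDefect x ^ 3 / (x * eulerProd (x ^ 2) ^ 24)) (𝓝 0) (𝓝 0) := by
    have hd : ContinuousAt (dslope eulerDefect 0) 0 :=
      continuousAt_dslope_same.mpr (differentiableOn_eulerDefect.differentiableAt unitBall_mem_nhds)
    have hA : ContinuousAt (fun x => eulerProd (x ^ 2)) 0 :=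
      ((differentiableOn_eulerProd_pow two_ne_zero).differentiableAt unitBall_mem_nhds).continuousAt
    have h2 : ContinuousAt
        (fun x => x ^ 2 * dslope eulerDefect 0 x ^ 3 / eulerProd (x ^ 2) ^ 24) 0 :=
      ContinuousAt.div (by fun_prop) (by fun_prop) (by simp [eulerProd_zero])
    have h3 := h2.tendsto
    simp only [ne_eq, OfNat.ofNat_ne_zero, not_false_eq_true, zero_pow, zero_mul, zero_div] at h3
    refine h3.congr fun x => ?_
    have hx : eulerDefect x = x * dslope eulerDefect 0 x := by
      simpa [eulerDefect_zero] using (sub_smul_dslope eulerDefect 0 x).symm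
    -- The limit is over the full neighbourhood of 0; at `x = 0` both sides are 0, the quotient
    -- because `0 / 0 = 0`.
    rcases eq_or_ne x 0 with rfl | h0
    · simp
    rw [hx]
    set d := dslope eulerDefect 0 x
    rw [show (x * d) ^ 3 = x * (x ^ 2 * d ^ 3) by ring, mul_div_mul_left _ _ h0]
  exact (h.comp (UpperHalfPlane.qParam_tendsto_atImInfty two_pos)).congr fun τ =>
    (jacobiQuotient_eq τ).symm

theorem differentiableOn_jacobiDefect :
    DifferentiableOn ℂ jacobiDefect {τ : ℂ | 0 < τ.im} :=
  ((differentiableOn_eta_div_two.pow 8).add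
    ((differentiableOn_eta_add_one_div_two.pow 8).const_mul _)).add
    ((differentiableOn_eta_two_mul.pow 8).const_mul _)

theorem eta_pow_24_add_one (τ : ℂ) : ModularForm.eta (τ + 1) ^ 24 = ModularForm.eta τ ^ 24 := by
  rw [show 24 = 8 * 3 by rfl, pow_mul, eta_pow_eight_add_one, mul_pow, exp_two_pi_div_three_pow,
    one_mul, ← pow_mul]

theorem eta_pow_24_neg_one_div {τ : ℂ} (hτ : 0 < τ.im) :
    ModularForm.eta (-1 / τ) ^ 24 = τ ^ 12 * ModularForm.eta τ ^ 24 := by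
  rw [show 24 = 8 * 3 by rfl, pow_mul, eta_pow_eight_neg_one_div hτ, mul_pow, ← pow_mul, ← pow_mul]

theorem jacobiQuotient_slash_T : (jacobiQuotient ∣[(0 : ℤ)] ModularGroup.T) = jacobiQuotient := by
  ext τ
  rw [SL_slash_apply, modular_T_smul]
  have e : ((((1 : ℝ) +ᵥ τ : ℍ)) : ℂ) = τ + 1 := by simp [add_comm]
  rw [neg_zero, zpow_zero, mul_one, jacobiQuotient, e, jacobiDefect_add_one, eta_pow_24_add_one,
    mul_pow, ← pow_mul, mul_comm 2 3, pow_mul, exp_two_pi_div_three_pow, one_pow, one_mul,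
    jacobiQuotient]

theorem jacobiQuotient_slash_S : (jacobiQuotient ∣[(0 : ℤ)] ModularGroup.S) = jacobiQuotient := by
  ext τ
  rw [SL_slash_apply, modular_S_smul]
  have e : ((UpperHalfPlane.mk (-τ : ℂ)⁻¹ τ.im_inv_neg_coe_pos : ℍ) : ℂ) = -1 / τ := by
    change (-τ : ℂ)⁻¹ = _
    rw [inv_neg, neg_div, one_div]
  rw [neg_zero, zpow_zero, mul_one, jacobiQuotient, e, jacobiDefect_neg_one_div τ.2,
    eta_pow_24_neg_one_div τ.2, mul_pow, ← pow_mul,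
    mul_div_mul_left _ _ (pow_ne_zero 12 (UpperHalfPlane.ne_zero τ)), jacobiQuotient]

/-- The quotient `jacobiQuotient` as a modular form of weight `0` and level one. -/
noncomputable def jacobiQuotientForm : ModularForm 𝒮ℒ 0 where
  toFun := jacobiQuotient
  slash_action_eq' A hA := by
    obtain ⟨A, rfl⟩ := hA
    exact SlashInvariantForm.slash_action_generators_SL2Z jacobiQuotient_slash_S
      jacobiQuotient_slash_T A
  holo' := by
    rw [UpperHalfPlane.mdifferentiable_iff]
    refine ((differentiableOn_jacobiDefect.pow 3).div (differentiableOn_eta.pow 24)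
      fun z hz => pow_ne_zero 24 (eta_ne_zero hz)).congr fun z hz => ?_
    simp [jacobiQuotient, ofComplex_apply_of_im_pos hz]
  bdd_at_cusps' hc := by
    rw [Subgroup.IsArithmetic.isCusp_iff_isCusp_SL2Z] at hc
    rw [OnePoint.isBoundedAt_iff_forall_SL2Z hc]
    intro γ _
    rw [SlashInvariantForm.slash_action_generators_SL2Z jacobiQuotient_slash_S
      jacobiQuotient_slash_T]
    exact tendsto_jacobiQuotient.isBigO_one ℝ

theorem jacobiDefect_eq_zero {τ : ℂ} (hτ : 0 < τ.im) : jacobiDefect τ = 0 := by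
  obtain ⟨c, hc⟩ := ModularFormClass.levelOne_weight_zero_const jacobiQuotientForm
  have hc' : jacobiQuotient = Function.const ℍ c := hc
  have h0 : c = 0 := by
    have h := tendsto_jacobiQuotient
    rw [hc'] at h
    exact tendsto_nhds_unique tendsto_const_nhds h
  have h1 : jacobiQuotient ⟨τ, hτ⟩ = 0 := by rw [hc', h0]; rfl
  rw [jacobiQuotient, div_eq_zero_iff, or_iff_left (pow_ne_zero 24 (eta_ne_zero hτ))] at h1
  exact eq_zero_of_pow_eq_zero h1

theorem eulerDefect_exp {τ : ℂ} (hτ : 0 < τ.im) : eulerDefect (exp (Real.pi * I * τ)) = 0 := by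
  have h := jacobiDefect_eq τ
  rw [jacobiDefect_eq_zero hτ] at h
  exact (mul_eq_zero.mp h.symm).resolve_left (exp_ne_zero _)

/-- **Jacobi's identity** for the Euler product. -/
theorem eulerDefect_eq_zero {x : ℂ} (hx : ‖x‖ < 1) : eulerDefect x = 0 := by
  rcases eq_or_ne x 0 with rfl | h0
  · exact eulerDefect_zero
  have h := eulerDefect_exp (Function.Periodic.im_invQParam_pos_of_norm_lt_one two_pos hx h0)
  have e := Function.Periodic.qParam_right_inv two_ne_zero h0
  rw [Function.Periodic.qParam] at e
  rwa [show (Real.pi * I * Function.Periodic.invQParam 2 x : ℂ) =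
    2 * Real.pi * I * Function.Periodic.invQParam 2 x / (2 : ℝ) by push_cast; ring, e] at h

/-! ### The transformation equations -/

/-- Here `h1 (τ + 1) + h1 τ` equals `jacobiDefect τ / η(τ)¹⁶`. -/
theorem h1_add_one {τ : ℂ} (hτ : 0 < τ.im) :
    h1 (τ + 1) = -h1 τ := by
  have hJ := jacobiDefect_eq_zero hτ
  have hw := exp_two_pi_div_three_pow
  have e2 : 2 * (τ + 1) = 2 * τ + 1 + 1 := by ring
  have h16 : ModularForm.eta (τ + 1) ^ 16 =
      exp (2 * Real.pi * I / 3) ^ 2 * ModularForm.eta τ ^ 16 := by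
    rw [show 16 = 8 * 2 by rfl, pow_mul, eta_pow_eight_add_one]
    ring
  rw [jacobiDefect] at hJ
  rw [h1, h1, e2, h16, eta_pow_eight_add_one, eta_pow_eight_add_one]
  have hη := eta_ne_zero hτ
  have hw0 : exp (2 * Real.pi * I / 3) ≠ 0 := exp_ne_zero _
  field_simp
  linear_combination (exp (2 * Real.pi * I / 3) ^ 2) * hJ -
    ModularForm.eta ((τ + 1) / 2) ^ 8 * hw

theorem etaQuotient_add_one (τ : ℂ) :
    ModularForm.eta (2 * (τ + 1)) ^ 8 / ModularForm.eta (τ + 1) ^ 16 =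
      ModularForm.eta (2 * τ) ^ 8 / ModularForm.eta τ ^ 16 := by
  have e2 : 2 * (τ + 1) = 2 * τ + 1 + 1 := by ring
  have h16 : ModularForm.eta (τ + 1) ^ 16 =
      exp (2 * Real.pi * I / 3) ^ 2 * ModularForm.eta τ ^ 16 := by
    rw [show 16 = 8 * 2 by rfl, pow_mul, eta_pow_eight_add_one]
    ring
  rw [h16, e2, eta_pow_eight_add_one, eta_pow_eight_add_one, ← mul_assoc, ← pow_two,
    mul_div_mul_left _ _ (pow_ne_zero 2 (exp_ne_zero _))]

theorem etaQuotient_neg_one_div {τ : ℂ} (hτ : 0 < τ.im) :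
    ModularForm.eta (2 * (-1 / τ)) ^ 8 / ModularForm.eta (-1 / τ) ^ 16 =
      τ ^ (-4 : ℤ) / 16 * (ModularForm.eta (τ / 2) ^ 8 / ModularForm.eta τ ^ 16) := by
  have h0 : τ ≠ 0 := fun h => by simp [h] at hτ
  have hη := eta_ne_zero hτ
  rw [show 16 = 8 * 2 by rfl, pow_mul, eta_pow_eight_neg_one_div hτ, eta_two_mul_neg_one_div hτ,
    zpow_neg]
  norm_cast
  field_simp

theorem etaQuotient_div_two_neg_one_div {τ : ℂ} (hτ : 0 < τ.im) :
    ModularForm.eta (-1 / τ / 2) ^ 8 / ModularForm.eta (-1 / τ) ^ 16 =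
      τ ^ (-4 : ℤ) * 16 * (ModularForm.eta (2 * τ) ^ 8 / ModularForm.eta τ ^ 16) := by
  have h0 : τ ≠ 0 := fun h => by simp [h] at hτ
  have hη := eta_ne_zero hτ
  rw [show ModularForm.eta (-1 / τ) ^ 16 = (ModularForm.eta (-1 / τ) ^ 8) ^ 2 by ring,
    eta_pow_eight_neg_one_div hτ, eta_div_two_neg_one_div hτ, zpow_neg]
  norm_cast
  field_simp

theorem solvesTransformationEquations : SolvesTransformationEquations h00 h0 h1 where
  f00_T τ _ := by rw [h00, h00, mul_div_assoc, mul_div_assoc, etaQuotient_add_one]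
  f0_T τ _ := by rw [h0, h0, mul_div_assoc, mul_div_assoc, etaQuotient_add_one]
  f1_T τ hτ := h1_add_one hτ
  -- On the right the `η(2τ)⁸` terms cancel: `56 - 35·8 + 28·8 = 0` here, and `56 - 3·8 - 4·8 = 0`
  -- for `f0_S`.
  f00_S τ hτ := by
    simp only [h00, h0, h1, mul_div_assoc]
    rw [etaQuotient_neg_one_div hτ]
    ring
  f0_S τ hτ := by
    simp only [h00, h0, h1, mul_div_assoc]
    rw [etaQuotient_neg_one_div hτ]
    ring
  f1_S τ hτ := by
    simp only [h00, h0, h1, mul_div_assoc]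
    rw [etaQuotient_neg_one_div hτ, etaQuotient_div_two_neg_one_div hτ]
    ring

end EightPoints

namespace EightPoints

open Complex Filter Topology

/-! ### Congruences modulo powers of the variable -/

/-- Holomorphic functions `f`, `g` on the unit disc with `f ≡ g` modulo `x ^ N`. -/
structure CongrModPow (N : ℕ) (f g : ℂ → ℂ) : Prop where
  left : DifferentiableOn ℂ f (Metric.ball 0 1)
  right : DifferentiableOn ℂ g (Metric.ball 0 1)
  exists_eq : ∃ r : ℂ → ℂ, DifferentiableOn ℂ r (Metric.ball 0 1) ∧
    ∀ x, ‖x‖ < 1 → f x = g x + x ^ N * r x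

namespace CongrModPow

variable {N : ℕ} {f g f' g' h : ℂ → ℂ}

theorem of_eq (hf : Differentiable ℂ f) (hg : Differentiable ℂ g) (r : ℂ → ℂ)
    (hr : Differentiable ℂ r) (h : ∀ x, f x = g x + x ^ N * r x) : CongrModPow N f g :=
  ⟨hf.differentiableOn, hg.differentiableOn, r, hr.differentiableOn, fun x _ => h x⟩

theorem refl (hf : DifferentiableOn ℂ f (Metric.ball 0 1)) : CongrModPow N f f :=
  ⟨hf, hf, 0, differentiableOn_const 0, fun x _ => by simp⟩

theorem trans (h₁ : CongrModPow N f g) (h₂ : CongrModPow N g h) : CongrModPow N f h := by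
  obtain ⟨hf, -, r, hr, e⟩ := h₁
  obtain ⟨-, hh, r', hr', e'⟩ := h₂
  exact ⟨hf, hh, r + r', hr.add hr', fun x hx => by
    rw [e x hx, e' x hx, Pi.add_apply]; ring⟩

theorem symm (h₁ : CongrModPow N f g) : CongrModPow N g f := by
  obtain ⟨hf, hg, r, hr, e⟩ := h₁
  exact ⟨hg, hf, -r, hr.neg, fun x hx => by rw [e x hx, Pi.neg_apply]; ring⟩

theorem add (h₁ : CongrModPow N f g) (h₂ : CongrModPow N f' g') :
    CongrModPow N (fun x => f x + f' x) (fun x => g x + g' x) := by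
  obtain ⟨hf, hg, r, hr, e⟩ := h₁
  obtain ⟨hf', hg', r', hr', e'⟩ := h₂
  exact ⟨hf.add hf', hg.add hg', r + r', hr.add hr', fun x hx => by
    rw [e x hx, e' x hx, Pi.add_apply]; ring⟩

theorem mul (h₁ : CongrModPow N f g) (h₂ : CongrModPow N f' g') :
    CongrModPow N (fun x => f x * f' x) (fun x => g x * g' x) := by
  obtain ⟨hf, hg, r, hr, e⟩ := h₁
  obtain ⟨hf', hg', r', hr', e'⟩ := h₂
  refine ⟨hf.mul hf', hg.mul hg', fun x => r x * f' x + g x * r' x,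
    (hr.mul hf').add (hg.mul hr'), fun x hx => ?_⟩
  linear_combination f' x * e x hx + g x * e' x hx

theorem pow (h₁ : CongrModPow N f g) (k : ℕ) :
    CongrModPow N (fun x => f x ^ k) (fun x => g x ^ k) := by
  induction k with
  | zero => simpa using refl (differentiableOn_const 1)
  | succ k ih => simpa only [pow_succ] using ih.mul h₁

theorem comp_pow (h₁ : CongrModPow N f g) {k : ℕ} (hk : k ≠ 0) :
    CongrModPow (k * N) (fun x => f (x ^ k)) (fun x => g (x ^ k)) := by
  obtain ⟨hf, hg, r, hr, e⟩ := h₁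
  have hb : ∀ x : ℂ, ‖x‖ < 1 → ‖x ^ k‖ < 1 := fun x hx => by
    rw [norm_pow]; exact pow_lt_one₀ (norm_nonneg x) hx hk
  have hm : Set.MapsTo (fun x : ℂ => x ^ k) (Metric.ball 0 1) (Metric.ball 0 1) := fun x hx => by
    simp only [Metric.mem_ball, dist_zero_right] at hx ⊢
    exact hb x hx
  have hd : DifferentiableOn ℂ (fun x : ℂ => x ^ k) (Metric.ball 0 1) := by fun_prop
  exact ⟨hf.comp hd hm, hg.comp hd hm, fun x => r (x ^ k), hr.comp hd hm, fun x hx => by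
    rw [e _ (hb x hx), ← pow_mul]⟩

theorem mono {M : ℕ} (h₁ : CongrModPow N f g) (hM : M ≤ N) : CongrModPow M f g := by
  obtain ⟨hf, hg, r, hr, e⟩ := h₁
  refine ⟨hf, hg, fun x => x ^ (N - M) * r x, DifferentiableOn.mul (by fun_prop) hr,
    fun x hx => ?_⟩
  rw [e x hx, ← mul_assoc, ← pow_add, Nat.add_sub_cancel' hM]

/-- A proposed expansion of a quotient is verified by multiplying out, so no series has to be
inverted. -/
theorem div (h₁ : CongrModPow N f (fun x => h x * g x)) (hh : Differentiable ℂ h)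
    (hg : DifferentiableOn ℂ g (Metric.ball 0 1)) (hg0 : ∀ x, ‖x‖ < 1 → g x ≠ 0) :
    CongrModPow N (fun x => f x / g x) h := by
  obtain ⟨hf, -, r, hr, e⟩ := h₁
  have hg0' : ∀ x ∈ Metric.ball (0 : ℂ) 1, g x ≠ 0 := fun x hx => hg0 x (by simpa using hx)
  refine ⟨hf.div hg hg0', hh.differentiableOn, fun x => r x / g x, hr.div hg hg0',
    fun x hx => ?_⟩
  rw [e x hx]
  have := hg0 x hx
  field_simp

/-- The remainder is holomorphic on the whole disc, so its Taylor series, shifted by `N`, supplies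
the coefficients beyond the prescribed ones. -/
theorem exists_hasSum {p : ℕ → ℂ}
    (h₁ : CongrModPow N f (fun x => ∑ i ∈ Finset.range N, p i * x ^ i)) :
    ∃ a : ℕ → ℂ, (∀ x, ‖x‖ < 1 → HasSum (fun n => a n * x ^ n) (f x)) ∧
      ∀ n < N, a n = p n := by
  obtain ⟨hf, -, r, hr, e⟩ := h₁
  refine ⟨fun n => if n < N then p n else
    ((n - N).factorial : ℂ)⁻¹ * iteratedDeriv (n - N) r 0, fun x hx => ?_,
    fun n hn => if_pos hn⟩
  have hs := (hasSum_taylorSeries_on_ball hr (by simpa using hx)).mul_left (x ^ N)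
  rw [e x hx, add_comm]
  have hsum : ∑ i ∈ Finset.range N, p i * x ^ i = ∑ i ∈ Finset.range N, (if i < N then p i else
      ((i - N).factorial : ℂ)⁻¹ * iteratedDeriv (i - N) r 0) * x ^ i :=
    Finset.sum_congr rfl fun i hi => by rw [if_pos (Finset.mem_range.mp hi)]
  rw [hsum]
  refine (hasSum_nat_add_iff N).mp ?_
  refine hs.congr_fun fun n => ?_
  simp only [add_lt_iff_neg_right, not_lt_zero, if_false, Nat.add_sub_cancel, sub_zero,
    smul_eq_mul, pow_add]
  ring

end CongrModPow

/-- One factor `x` is removed at a time: `g` vanishes at 0 and `dslope g 0` is again holomorphic,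
with the order of the bound lowered by one. -/
theorem exists_factor_of_isBigO {g : ℂ → ℂ} (hg : DifferentiableOn ℂ g (Metric.ball 0 1)) {N : ℕ}
    (h : g =O[𝓝[≠] 0] fun x => x ^ N) :
    ∃ r : ℂ → ℂ, DifferentiableOn ℂ r (Metric.ball 0 1) ∧ ∀ x, g x = x ^ N * r x := by
  induction N generalizing g with
  | zero => exact ⟨g, hg, fun x => by simp⟩
  | succ N ih =>
    have hc : ContinuousAt g 0 := (hg.differentiableAt unitBall_mem_nhds).continuousAt
    have h0 : g 0 = 0 := by
      refine tendsto_nhds_unique (hc.tendsto.mono_left nhdsWithin_le_nhds) (h.trans_tendsto ?_)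
      have : Tendsto (fun x : ℂ => x ^ (N + 1)) (𝓝 0) (𝓝 (0 ^ (N + 1))) :=
        (continuous_pow (N + 1)).tendsto 0
      rw [zero_pow N.succ_ne_zero] at this
      exact this.mono_left nhdsWithin_le_nhds
    have hs : ∀ x, g x = x * dslope g 0 x := fun x => by
      simpa [h0] using (sub_smul_dslope g 0 x).symm
    have hO : dslope g 0 =O[𝓝[≠] 0] fun x => x ^ N := by
      refine ((Asymptotics.isBigO_refl (fun x : ℂ => x⁻¹) _).mul h).congr' ?_ ?_
      · filter_upwards [self_mem_nhdsWithin] with x hx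
        rw [hs x, inv_mul_cancel_left₀ hx]
      · filter_upwards [self_mem_nhdsWithin] with x hx
        rw [pow_succ', inv_mul_cancel_left₀ hx]
    obtain ⟨r, hr, e⟩ := ih ((differentiableOn_dslope unitBall_mem_nhds).mpr hg) hO
    exact ⟨r, hr, fun x => by rw [hs x, e x, pow_succ']; ring⟩

/-- The tail of the Euler product is `1 + O(xᵏ)`. -/
theorem norm_tprod_one_sub_pow_sub_one_le {x : ℂ} (hx : ‖x‖ ≤ 1 / 2) {k : ℕ} (hk : k ≠ 0) :
    ‖∏' n : ℕ, (1 - x ^ (n + k)) - 1‖ ≤ 4 * ‖x‖ ^ k := by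
  have hx1 : ‖x‖ < 1 := hx.trans_lt (by norm_num)
  have hs : Summable fun n : ℕ => ‖-x ^ (n + k)‖ := by
    simpa using (summable_nat_add_iff k).mpr (summable_geometric_of_lt_one (norm_nonneg _) hx1)
  have hm : Multipliable fun n : ℕ => 1 - x ^ (n + k) := by
    simpa [sub_eq_add_neg] using multipliable_one_add_of_summable hs
  have ht := (hm.hasProd.tendsto_prod_nat.sub_const 1).norm
  refine le_of_tendsto ht (Eventually.of_forall fun N => ?_)
  have hb : ∑ n ∈ Finset.range N, ‖-x ^ (n + k)‖ ≤ 2 * ‖x‖ ^ k := by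
    refine (hs.sum_le_tsum _ fun _ _ => norm_nonneg _).trans ?_
    simp only [norm_neg, norm_pow, pow_add, norm_mul]
    rw [tsum_mul_right, tsum_geometric_of_lt_one (norm_nonneg _) hx1]
    refine mul_le_mul_of_nonneg_right ?_ (by positivity)
    rw [inv_le_comm₀ (by linarith) two_pos]
    linarith
  -- This puts `t = 2‖x‖ᵏ` in `[0, 1]`, where `|eᵗ - 1| ≤ 2t`; hence the constant 4.
  have hk1 : ‖x‖ ^ k ≤ 1 / 2 := (pow_le_of_le_one (norm_nonneg x) hx1.le hk).trans hx
  have h := Finset.norm_prod_one_add_sub_one_le (Finset.range N) fun n => -x ^ (n + k)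
  simp only [← sub_eq_add_neg] at h
  have hexp := Real.abs_exp_sub_one_le (x := 2 * ‖x‖ ^ k)
    (by rw [abs_of_nonneg (by positivity)]; linarith)
  rw [abs_of_nonneg (by positivity : 0 ≤ 2 * ‖x‖ ^ k)] at hexp
  have := Real.exp_le_exp.mpr hb
  have := le_abs_self (Real.exp (2 * ‖x‖ ^ k) - 1)
  linarith

theorem eulerProd_congr : CongrModPow 5 eulerProd (fun x => 1 - x - x ^ 2) := by
  have hd : DifferentiableOn ℂ (fun x => eulerProd x - (1 - x - x ^ 2)) (Metric.ball 0 1) :=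
    differentiableOn_eulerProd.sub (by fun_prop)
  suffices h : (fun x => eulerProd x - (1 - x - x ^ 2)) =O[𝓝 0] fun x => x ^ 5 by
    obtain ⟨r, hr, e⟩ := exists_factor_of_isBigO hd (h.mono nhdsWithin_le_nhds)
    exact ⟨differentiableOn_eulerProd, by fun_prop, r, hr, fun x _ => by rw [← e x]; ring⟩
  have hsplit : ∀ x : ℂ, ‖x‖ ≤ 1 / 2 → eulerProd x =
      (1 - x) * (1 - x ^ 2) * (1 - x ^ 3) * (1 - x ^ 4) * ∏' n : ℕ, (1 - x ^ (n + 5)) := by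
    intro x hx
    have hm := ModularForm.multipliable_one_sub_pow (q := x) (hx.trans_lt (by norm_num))
    have hx1 : ‖x‖ < 1 := hx.trans_lt (by norm_num)
    have hs : Summable fun n : ℕ => ‖-x ^ (n + 5)‖ := by
      simpa using (summable_nat_add_iff 5).mpr (summable_geometric_of_lt_one (norm_nonneg _) hx1)
    have hm5 : Multipliable fun n : ℕ => 1 - x ^ (n + 4 + 1) := by
      simpa [sub_eq_add_neg] using multipliable_one_add_of_summable hs
    have h := Multipliable.prod_mul_tprod_nat_mul' (f := fun n : ℕ => 1 - x ^ (n + 1)) hm5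
    rw [eulerProd, ← h]
    simp [Finset.prod_range_succ]
  have htail : (fun x : ℂ => ∏' n : ℕ, (1 - x ^ (n + 5)) - 1) =O[𝓝 0] fun x => x ^ 5 := by
    refine Asymptotics.IsBigO.of_bound 4 ?_
    filter_upwards [Metric.closedBall_mem_nhds (0 : ℂ) one_half_pos] with x hx
    rw [norm_pow]
    exact norm_tprod_one_sub_pow_sub_one_le (by simpa using hx) (by norm_num)
  have hbdd : ∀ f : ℂ → ℂ, Continuous f → f =O[𝓝 0] fun _ => (1 : ℂ) := fun f hf =>
    (hf.tendsto 0).isBigO_one ℂ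
  have h1 := (hbdd (fun x => (1 - x) * (1 - x ^ 2) * (1 - x ^ 3) * (1 - x ^ 4))
    (by fun_prop)).mul htail
  -- The product of the first four factors is `1 - x - x² + x⁵(2 - x³ - x⁴ + x⁵)`.
  have h2 := (hbdd (fun x => 2 - x ^ 3 - x ^ 4 + x ^ 5) (by fun_prop)).mul
    (Asymptotics.isBigO_refl (fun x : ℂ => x ^ 5) (𝓝 0))
  simp only [one_mul] at h1 h2
  refine (h1.add h2).congr' ?_ EventuallyEq.rfl
  filter_upwards [Metric.closedBall_mem_nhds (0 : ℂ) one_half_pos] with x hx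
  rw [hsplit x (by simpa using hx)]
  ring

end EightPoints

namespace EightPoints

open Complex Filter Topology

/-! ### The `q`-expansions -/

/-- Four squarings, each truncated modulo `x³`; the functions supplied are the discarded terms
divided by `x³`. -/
theorem eulerProd_pow_sixteen_congr :
    CongrModPow 3 (fun x => eulerProd x ^ 16) (fun x => 1 - 16 * x + 104 * x ^ 2) := by
  have h2 := ((eulerProd_congr.mono (show 3 ≤ 5 by norm_num)).pow 2).trans
    (.of_eq (g := fun x => 1 - 2 * x - x ^ 2) (by fun_prop) (by fun_prop)
      (fun x => 2 + x) (by fun_prop) fun x => by ring)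
  have h4 := (h2.pow 2).trans
    (.of_eq (g := fun x => 1 - 4 * x + 2 * x ^ 2) (by fun_prop) (by fun_prop)
      (fun x => 4 + x) (by fun_prop) fun x => by ring)
  have h8 := (h4.pow 2).trans
    (.of_eq (g := fun x => 1 - 8 * x + 20 * x ^ 2) (by fun_prop) (by fun_prop)
      (fun x => -16 + 4 * x) (by fun_prop) fun x => by ring)
  have h16 := (h8.pow 2).trans
    (.of_eq (g := fun x => 1 - 16 * x + 104 * x ^ 2) (by fun_prop) (by fun_prop)
      (fun x => -320 + 400 * x) (by fun_prop) fun x => by ring)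
  simpa only [← pow_mul, Nat.reduceMul] using h16

theorem eulerProd_pow_eight_congr_two :
    CongrModPow 2 (fun x => eulerProd x ^ 8) (fun x => 1 - 8 * x) :=
  ((eulerProd_congr.mono (show 2 ≤ 5 by norm_num)).pow 8).trans <|
    (CongrModPow.pow (.of_eq (g := fun x => 1 - x) (by fun_prop) (by fun_prop)
      (fun _ => -1) (by fun_prop) fun x => by ring) 8).trans <|
    .of_eq (by fun_prop) (by fun_prop)
      (fun x => 28 - 56 * x + 70 * x ^ 2 - 56 * x ^ 3 + 28 * x ^ 4 - 8 * x ^ 5 + x ^ 6)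
      (by fun_prop) fun x => by ring

theorem eulerProd_pow_eight_congr :
    CongrModPow 5 (fun x => eulerProd x ^ 8) (fun x => 1 - 8 * x + 20 * x ^ 2 - 70 * x ^ 4) :=
  (eulerProd_congr.pow 8).trans <|
    .of_eq (by fun_prop) (by fun_prop)
      (fun x => 56 + 112 * x - 120 * x ^ 2 - 125 * x ^ 3 + 120 * x ^ 4 + 112 * x ^ 5 - 56 * x ^ 6
        - 70 * x ^ 7 + 20 * x ^ 9 + 8 * x ^ 10 + x ^ 11)
      (by fun_prop) fun x => by ring

theorem norm_pow_lt_one {x : ℂ} (hx : ‖x‖ < 1) {k : ℕ} (hk : k ≠ 0) : ‖x ^ k‖ < 1 := by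
  rw [norm_pow]
  exact pow_lt_one₀ (norm_nonneg x) hx hk

/-- The expansion of `η(2τ)⁸ / η(τ)¹⁶` in powers of `q`, as a function of `q`. -/
noncomputable def evenQuotient (x : ℂ) : ℂ := eulerProd (x ^ 2) ^ 8 / eulerProd x ^ 16

/-- The function `x h₁`, as a function of `x = q^{1/2}`. -/
noncomputable def oddQuotient (x : ℂ) : ℂ :=
  (eulerProd x ^ 8 + 8 * x * eulerProd (x ^ 4) ^ 8) / eulerProd (x ^ 2) ^ 16

theorem evenQuotient_congr :
    CongrModPow 3 evenQuotient (fun x => 1 + 16 * x + 144 * x ^ 2) := by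
  refine CongrModPow.div ?_ (by fun_prop) (differentiableOn_eulerProd.pow 16)
    fun x hx => pow_ne_zero 16 (eulerProd_ne_zero hx)
  have h1 := (eulerProd_pow_eight_congr_two.comp_pow two_ne_zero).mono (show 3 ≤ 2 * 2 by norm_num)
  have h2 := (CongrModPow.refl (N := 3) (f := fun x => 1 + 16 * x + 144 * x ^ 2)
    (by fun_prop)).mul eulerProd_pow_sixteen_congr
  refine h1.trans (CongrModPow.trans ?_ h2.symm)
  exact .of_eq (by fun_prop) (by fun_prop) (fun x => 640 - 14976 * x) (by fun_prop)
    fun x => by ring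

/-- Modulo `x⁵` the numerator is `1 + 20x² - 70x⁴`, its linear terms cancelling. With `y = x²` this
is `(1 + 36y + 402y²)(1 - 16y + 104y²)` modulo `y³`. -/
theorem oddQuotient_congr :
    CongrModPow 5 oddQuotient (fun x => 1 + 36 * x ^ 2 + 402 * x ^ 4) := by
  refine CongrModPow.div ?_ (by fun_prop)
    ((differentiableOn_eulerProd_pow two_ne_zero).pow 16)
    fun x hx => pow_ne_zero 16 (eulerProd_ne_zero (norm_pow_lt_one hx two_ne_zero))
  have h1 : CongrModPow 5 (fun x => eulerProd (x ^ 4) ^ 8) (fun x => 1 - 8 * x ^ 4) :=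
    (eulerProd_pow_eight_congr_two.comp_pow four_ne_zero).mono (by norm_num)
  have h2 := eulerProd_pow_eight_congr.add
    ((CongrModPow.refl (N := 5) (f := fun x => 8 * x) (by fun_prop)).mul h1)
  have h3 : CongrModPow 5 (fun x => eulerProd (x ^ 2) ^ 16)
      (fun x => 1 - 16 * x ^ 2 + 104 * (x ^ 2) ^ 2) :=
    (eulerProd_pow_sixteen_congr.comp_pow two_ne_zero).mono (by norm_num)
  have h4 := (CongrModPow.refl (N := 5) (f := fun x => 1 + 36 * x ^ 2 + 402 * x ^ 4)
    (by fun_prop)).mul h3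
  refine h2.trans (CongrModPow.trans ?_ h4.symm)
  exact .of_eq (by fun_prop) (by fun_prop) (fun x => 2688 * x - 41808 * x ^ 3 - 64)
    (by fun_prop) fun x => by ring

/-- The numerators at `x` and `-x` differ by `eulerDefect x`, so evenness is exactly Jacobi's
identity. -/
theorem oddQuotient_neg {x : ℂ} (hx : ‖x‖ < 1) : oddQuotient (-x) = oddQuotient x := by
  have h := eulerDefect_eq_zero hx
  rw [eulerDefect] at h
  rw [oddQuotient, oddQuotient, neg_sq, show (-x) ^ 4 = x ^ 4 by ring]
  congr 1
  linear_combination -h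

theorem etaQuotient_eq (τ : ℂ) :
    ModularForm.eta (2 * τ) ^ 8 / ModularForm.eta τ ^ 16 =
      evenQuotient (exp (2 * Real.pi * I * τ)) := by
  have a1 : exp (2 * Real.pi * I * (2 * τ)) = exp (2 * Real.pi * I * τ) ^ 2 := by
    rw [← exp_nat_mul]; congr 1; push_cast; ring
  have a2 : exp (2 * Real.pi * I * (2 * τ) / 3) = exp (2 * Real.pi * I * τ / 3) ^ 2 := by
    rw [← exp_nat_mul]; congr 1; push_cast; ring
  rw [show ModularForm.eta τ ^ 16 = (ModularForm.eta τ ^ 8) ^ 2 by ring, eta_pow_eight,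
    eta_pow_eight, a1, a2, mul_pow, ← pow_mul,
    mul_div_mul_left _ _ (pow_ne_zero 2 (exp_ne_zero _)), evenQuotient]

theorem h1_eq (τ : ℂ) :
    h1 τ = (exp (Real.pi * I * τ))⁻¹ * oddQuotient (exp (Real.pi * I * τ)) := by
  have a0 : exp (2 * Real.pi * I * τ) = exp (Real.pi * I * τ) ^ 2 := by
    rw [← exp_nat_mul]; congr 1; push_cast; ring
  have a1 : exp (2 * Real.pi * I * (τ / 2)) = exp (Real.pi * I * τ) := by congr 1; ring
  have a2 : exp (2 * Real.pi * I * τ / 3) = exp (2 * Real.pi * I * (τ / 2) / 3) ^ 2 := by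
    rw [← exp_nat_mul]; congr 1; push_cast; ring
  have a3 : exp (Real.pi * I * τ) = exp (2 * Real.pi * I * (τ / 2) / 3) ^ 3 := by
    rw [← exp_nat_mul]; congr 1; push_cast; ring
  -- All prefactors are powers of `y = e^{πiτ/3}`: `η(τ/2)⁸` carries `y` and `η(τ)¹⁶` carries `y⁴`,
  -- leaving `y⁻³ = x⁻¹`.
  have hy := exp_ne_zero (2 * Real.pi * I * (τ / 2) / 3)
  rw [h1, mul_div_assoc, etaQuotient_eq,
    show ModularForm.eta τ ^ 16 = (ModularForm.eta τ ^ 8) ^ 2 by ring, eta_pow_eight,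
    eta_pow_eight, a0, a1, a2, evenQuotient, oddQuotient, ← pow_mul]
  simp only [Nat.reduceMul]
  have hx : exp (Real.pi * I * τ) ≠ 0 := exp_ne_zero _
  generalize exp (2 * Real.pi * I * (τ / 2) / 3) = y at *
  generalize exp (Real.pi * I * τ) = x at *
  subst a3
  generalize eulerProd ((y ^ 3) ^ 2) = B
  -- Since `τ` is arbitrary, `B` may be 0; both sides are then 0 by division by zero.
  rcases eq_or_ne B 0 with rfl | hB
  · simp
  field_simp
  ring

theorem exists_evenQuotient_hasSum : ∃ a : ℕ → ℂ,
    (∀ x, ‖x‖ < 1 → HasSum (fun n => a n * x ^ n) (evenQuotient x)) ∧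
      a 0 = 1 ∧ a 1 = 16 ∧ a 2 = 144 := by
  have h := evenQuotient_congr
  have e : (fun x : ℂ => 1 + 16 * x + 144 * x ^ 2) =
      fun x => ∑ i ∈ Finset.range 3, ([1, 16, 144] : List ℂ).getD i 0 * x ^ i := by
    ext x
    simp [Finset.sum_range_succ]
  rw [e] at h
  obtain ⟨a, ha, hc⟩ := h.exists_hasSum (p := fun i => ([1, 16, 144] : List ℂ).getD i 0)
  exact ⟨a, ha, hc 0 (by norm_num), hc 1 (by norm_num),
    hc 2 (by norm_num)⟩

theorem exists_oddQuotient_hasSum : ∃ a : ℕ → ℂ,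
    (∀ x, ‖x‖ < 1 → HasSum (fun n => a n * x ^ (2 * n)) (oddQuotient x)) ∧
      a 0 = 1 ∧ a 1 = 36 ∧ a 2 = 402 := by
  have h := oddQuotient_congr
  have e : (fun x : ℂ => 1 + 36 * x ^ 2 + 402 * x ^ 4) = fun x => ∑ i ∈ Finset.range 5,
      ([1, 0, 36, 0, 402] : List ℂ).getD i 0 * x ^ i := by
    ext x
    simp [Finset.sum_range_succ]
  rw [e] at h
  obtain ⟨a, ha, hc⟩ :=
    h.exists_hasSum (p := fun i => ([1, 0, 36, 0, 402] : List ℂ).getD i 0)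
  refine ⟨fun n => a (2 * n), fun x hx => ?_, hc 0 (by norm_num),
    hc 2 (by norm_num), hc 4 (by norm_num)⟩
  have h1 := ha x hx
  have h2 := ha (-x) (by rwa [norm_neg])
  rw [oddQuotient_neg hx] at h2
  -- Averaging the series at `x` and `-x` removes the odd terms without using uniqueness of
  -- coefficients.
  have h3 := (h1.add h2).mul_left (1 / 2)
  rw [show 1 / 2 * (oddQuotient x + oddQuotient x) = oddQuotient x by ring] at h3
  have hinj : Function.Injective fun n : ℕ => 2 * n := fun m n hmn => by simpa using hmn
  refine ((hinj.hasSum_iff ?_).mpr h3).congr_fun fun n => ?_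
  · intro n hn
    have hodd : Odd n := by
      by_contra hev
      obtain ⟨k, rfl⟩ := even_iff_two_dvd.mp (Nat.not_odd_iff_even.mp hev)
      exact hn ⟨k, rfl⟩
    rw [hodd.neg_pow]
    ring
  · simp only [Function.comp_apply]
    rw [(even_two_mul n).neg_pow]
    ring

theorem exists_etaQuotient_hasQExpansion (c : ℂ) : ∃ a : ℕ → ℂ,
    HasQExpansion (fun τ => c * ModularForm.eta (2 * τ) ^ 8 / ModularForm.eta τ ^ 16) 0 a ∧
      a 0 = c ∧ a 1 = c * 16 ∧ a 2 = c * 144 := by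
  obtain ⟨a, ha, h0, h1, h2⟩ := exists_evenQuotient_hasSum
  refine ⟨fun n => c * a n, fun τ hτ => ?_, by simp [h0], by simp [h1], by simp [h2]⟩
  beta_reduce
  rw [mul_div_assoc, etaQuotient_eq]
  refine ((ha _ (norm_exp_lt_one hτ)).mul_left c).congr_fun fun n => ?_
  rw [← exp_nat_mul, ← mul_assoc]
  congr 2
  ring

theorem h00_hasQExpansion : ∃ a : ℕ → ℂ, HasQExpansion h00 0 a ∧
    a 0 = 56 ∧ a 1 = 896 ∧ a 2 = 8064 := by
  obtain ⟨a, ha, e0, e1, e2⟩ := exists_etaQuotient_hasQExpansion 56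
  exact ⟨a, ha, e0, e1.trans (by norm_num), e2.trans (by norm_num)⟩

theorem h0_hasQExpansion : ∃ a : ℕ → ℂ, HasQExpansion h0 0 a ∧
    a 0 = -8 ∧ a 1 = -128 ∧ a 2 = -1152 := by
  obtain ⟨a, ha, e0, e1, e2⟩ := exists_etaQuotient_hasQExpansion (-8)
  exact ⟨a, ha, e0, e1.trans (by norm_num), e2.trans (by norm_num)⟩

theorem h1_hasQExpansion : ∃ a : ℕ → ℂ, HasQExpansion h1 (-(1 / 2)) a ∧
    a 0 = 1 ∧ a 1 = 36 ∧ a 2 = 402 := by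
  obtain ⟨a, ha, hc⟩ := exists_oddQuotient_hasSum
  refine ⟨a, fun τ hτ => ?_, hc⟩
  rw [h1_eq]
  refine ((ha _ (norm_exp_pi_lt_one hτ)).mul_left _).congr_fun fun n => ?_
  rw [← exp_nat_mul, ← exp_neg, mul_left_comm, ← exp_add]
  congr 2
  push_cast
  ring

/-! ### Holomorphy of the three functions -/

theorem differentiableOn_h00 : DifferentiableOn ℂ h00 {τ : ℂ | 0 < τ.im} :=
  ((differentiableOn_eta_two_mul.pow 8).const_mul 56).div (differentiableOn_eta.pow 16)
    fun _ hτ => pow_ne_zero 16 (eta_ne_zero hτ)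

theorem differentiableOn_h0 : DifferentiableOn ℂ h0 {τ : ℂ | 0 < τ.im} :=
  ((differentiableOn_eta_two_mul.pow 8).const_mul (-8)).div (differentiableOn_eta.pow 16)
    fun _ hτ => pow_ne_zero 16 (eta_ne_zero hτ)

theorem differentiableOn_h1 : DifferentiableOn ℂ h1 {τ : ℂ | 0 < τ.im} :=
  (((differentiableOn_eta_two_mul.pow 8).const_mul 8).div (differentiableOn_eta.pow 16)
    fun _ hτ => pow_ne_zero 16 (eta_ne_zero hτ)).add
  ((differentiableOn_eta_div_two.pow 8).div (differentiableOn_eta.pow 16)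
    fun _ hτ => pow_ne_zero 16 (eta_ne_zero hτ))

end EightPoints

namespace EightPoints

open Complex

/-! ### The discriminant group -/

theorem formN_apply (x y : AmbientN) : formN x y =
    (x.1 0 * y.1 1 + x.1 1 * y.1 0) + 2 * (x.2.1 0 * y.2.1 1 + x.2.1 1 * y.2.1 0)
      - (∑ i, x.2.2.1 i * y.2.2.1 i) - (∑ i, x.2.2.2 i * y.2.2.2 i) := rfl

/-- The dual of `D₄`: integral vectors and their translates by `(1/2, 1/2, 1/2, 1/2)`. -/
def IsDualD4 (v : Fin 4 → ℚ) : Prop := ∃ (d : ℤ) (z : Fin 4 → ℤ), ∀ i, v i = z i + d / 2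

theorem IsDualD4.dot_integral {v w : Fin 4 → ℚ} (hv : IsDualD4 v) (hw : w ∈ latticeD4) :
    ∃ m : ℤ, ∑ i, v i * w i = m := by
  obtain ⟨d, z, hz⟩ := hv
  obtain ⟨u, hu, s, hs⟩ := hw
  refine ⟨∑ i, z i * u i + d * s, ?_⟩
  have hs' : (∑ i, (u i : ℚ)) = s + s := by exact_mod_cast hs
  simp only [hz, hu, add_mul, Finset.sum_add_distrib, ← Finset.mul_sum, hs']
  push_cast
  ring

/-- The hypothesis is integrality against `e_i + e_0` in `D₄`. The case `i = 0` makes `d = 2 v 0` an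
integer, and the rest puts every coordinate in `d/2 + ℤ`. -/
theorem isDualD4_of_add_integral {v : Fin 4 → ℚ} (h : ∀ i, ∃ m : ℤ, v i + v 0 = m) :
    IsDualD4 v := by
  choose m hm using h
  have h0 := hm 0
  refine ⟨m 0, fun i => m i - m 0, fun i => ?_⟩
  have := hm i
  push_cast
  linarith

theorem single_mem_intPlane (i : Fin 2) : (Pi.single i 1 : Fin 2 → ℚ) ∈ intPlane :=
  ⟨Pi.single i 1, fun j => by by_cases h : j = i <;> simp [h]⟩

theorem single_add_single_mem_latticeD4 (i : Fin 4) :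
    (Pi.single i 1 + Pi.single 0 1 : Fin 4 → ℚ) ∈ latticeD4 :=
  ⟨Pi.single i 1 + Pi.single 0 1, fun j => by simp [Pi.single_apply], by
    simp [Finset.sum_add_distrib]⟩

theorem mem_dualN_iff {x : AmbientN} : x ∈ dualN ↔
    (∀ i, ∃ z : ℤ, x.1 i = z) ∧ (∀ i, ∃ z : ℤ, 2 * x.2.1 i = z) ∧
      IsDualD4 x.2.2.1 ∧ IsDualD4 x.2.2.2 := by
  refine ⟨fun hx => ⟨fun i => ?_, fun i => ?_, isDualD4_of_add_integral fun i => ?_,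
    isDualD4_of_add_integral fun i => ?_⟩, ?_⟩
  -- The hyperbolic plane pairs coordinates crosswise, so index `1 - i` isolates coordinate `i`.
  · obtain ⟨m, hm⟩ := formN_dual (y := (Pi.single (1 - i) 1, 0, 0, 0)) hx
      ⟨single_mem_intPlane _, zero_mem _, zero_mem _, zero_mem _⟩
    refine ⟨m, ?_⟩
    rw [← hm, formN_apply]
    fin_cases i <;> simp
  · obtain ⟨m, hm⟩ := formN_dual (y := (0, Pi.single (1 - i) 1, 0, 0)) hx
      ⟨zero_mem _, single_mem_intPlane _, zero_mem _, zero_mem _⟩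
    refine ⟨m, ?_⟩
    rw [← hm, formN_apply]
    fin_cases i <;> simp
  · obtain ⟨m, hm⟩ := formN_dual (y := (0, 0, Pi.single i 1 + Pi.single 0 1, 0)) hx
      ⟨zero_mem _, zero_mem _, single_add_single_mem_latticeD4 i, zero_mem _⟩
    refine ⟨-m, ?_⟩
    push_cast
    rw [← hm, formN_apply]
    simp [mul_add, Finset.sum_add_distrib, Pi.single_apply]
  · obtain ⟨m, hm⟩ := formN_dual (y := (0, 0, 0, Pi.single i 1 + Pi.single 0 1)) hx
      ⟨zero_mem _, zero_mem _, zero_mem _, single_add_single_mem_latticeD4 i⟩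
    refine ⟨-m, ?_⟩
    push_cast
    rw [← hm, formN_apply]
    simp [mul_add, Finset.sum_add_distrib, Pi.single_apply]
  · rintro ⟨h1, h2, h3, h4⟩ y ⟨⟨a, ha⟩, ⟨b, hb⟩, hc, hd⟩
    choose u hu using h1
    choose v hv using h2
    obtain ⟨m, hm⟩ := h3.dot_integral hc
    obtain ⟨n, hn⟩ := h4.dot_integral hd
    refine Submodule.mem_one.mpr ⟨(u 0 * a 1 + u 1 * a 0) + (v 0 * b 1 + v 1 * b 0) - m - n, ?_⟩
    rw [formN_apply, hm, hn]
    simp only [hu, ha, hb, algebraMap_int_eq, eq_intCast]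
    push_cast
    simp only [← hv]
    ring

theorem mem_dualN_of_plane (i : Fin 2) :
    ((0, Pi.single i (1 / 2), 0, 0) : AmbientN) ∈ dualN :=
  mem_dualN_iff.mpr ⟨fun _ => ⟨0, by simp⟩, fun j => by
    by_cases h : j = i
    · exact ⟨1, by simp [h]⟩
    · exact ⟨0, by simp [h]⟩, ⟨0, 0, by simp⟩, ⟨0, 0, by simp⟩⟩

theorem isDualD4_single (i : Fin 4) : IsDualD4 (Pi.single i 1) :=
  ⟨0, Pi.single i 1, fun j => by by_cases h : j = i <;> simp [h]⟩

theorem isDualD4_half : IsDualD4 fun _ => 1 / 2 := ⟨1, 0, fun j => by simp⟩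

/-- Pairing with unit vectors gives integrality, and pairing with `(1/2, 1/2, 1/2, 1/2)` gives the
parity of the sum. -/
theorem mem_latticeD4_of_dot_integral {v : Fin 4 → ℚ}
    (h : ∀ w, IsDualD4 w → ∃ m : ℤ, ∑ i, v i * w i = m) : v ∈ latticeD4 := by
  choose m hm using fun i => h _ (isDualD4_single i)
  obtain ⟨n, hn⟩ := h _ isDualD4_half
  have hm' : ∀ i, v i = m i := fun i => by simpa [Pi.single_apply] using hm i
  refine ⟨m, hm', n, ?_⟩
  simp only [hm', ← Finset.sum_mul] at hn
  have : (∑ i, (m i : ℚ)) = n + n := by linarith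
  exact_mod_cast this

/-- The lattice is the dual of its dual. -/
theorem mem_latticeN_of_form_integral {x : AmbientN} (hx : x ∈ dualN)
    (h : ∀ y ∈ dualN, ∃ m : ℤ, formN x y = m) : x ∈ latticeN := by
  obtain ⟨h1, -, -, -⟩ := mem_dualN_iff.mp hx
  have z4 : IsDualD4 0 := ⟨0, 0, by simp⟩
  refine ⟨?_, ?_, mem_latticeD4_of_dot_integral fun w hw => ?_,
    mem_latticeD4_of_dot_integral fun w hw => ?_⟩
  · choose z hz using h1
    exact ⟨z, hz⟩
  · have h2 : ∀ i, ∃ z : ℤ, x.2.1 i = z := fun i => by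
      obtain ⟨m, hm⟩ := h _ (mem_dualN_of_plane (1 - i))
      refine ⟨m, ?_⟩
      rw [← hm, formN_apply]
      fin_cases i <;> simp <;> ring
    choose z hz using h2
    exact ⟨z, hz⟩
  · obtain ⟨m, hm⟩ := h (0, 0, w, 0)
      (mem_dualN_iff.mpr ⟨fun _ => ⟨0, by simp⟩, fun _ => ⟨0, by simp⟩, hw, z4⟩)
    refine ⟨-m, ?_⟩
    push_cast
    rw [← hm, formN_apply]
    simp
  · obtain ⟨m, hm⟩ := h (0, 0, 0, w)
      (mem_dualN_iff.mpr ⟨fun _ => ⟨0, by simp⟩, fun _ => ⟨0, by simp⟩, z4, hw⟩)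
    refine ⟨-m, ?_⟩
    push_cast
    rw [← hm, formN_apply]
    simp

theorem IsDualD4.dot_self_integral {v : Fin 4 → ℚ} (hv : IsDualD4 v) :
    ∃ m : ℤ, ∑ i, v i * v i = m := by
  obtain ⟨d, z, hz⟩ := hv
  refine ⟨∑ i, z i * z i + d * ∑ i, z i + d * d, ?_⟩
  simp only [hz, Fin.sum_univ_four]
  push_cast
  ring

/-- This makes `chi` a sign, so that the type of a nonzero class is read off from `chi`. -/
theorem formN_self_integral {x : AmbientN} (hx : x ∈ dualN) : ∃ m : ℤ, formN x x = m := by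
  obtain ⟨h1, h2, h3, h4⟩ := mem_dualN_iff.mp hx
  choose u hu using h1
  choose v hv using h2
  obtain ⟨m, hm⟩ := h3.dot_self_integral
  obtain ⟨n, hn⟩ := h4.dot_self_integral
  refine ⟨2 * (u 0 * u 1) + v 0 * v 1 - m - n, ?_⟩
  rw [formN_apply, hm, hn]
  push_cast
  simp only [hu, ← hv]
  ring

/-! ### The characters of the discriminant group -/

theorem expPi_coe (x : ℚ) : expPi (x : AddCircle (2 : ℚ)) = exp (Real.pi * I * x) := rfl

theorem expTwoPi_coe (x : ℚ) : expTwoPi (x : AddCircle (1 : ℚ)) = exp (2 * Real.pi * I * x) := rfl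

theorem exp_pi_mul_I_mul_intCast (m : ℤ) : exp (Real.pi * I * m) = (-1) ^ m := by
  rw [mul_comm, exp_int_mul, exp_pi_mul_I]

/-- The sign `e^{πi q_N(α)}`. -/
noncomputable def chi (α : DiscN) : ℂ := expPi (qN α)

/-- The bicharacter `e^{2πi⟨α, β⟩}`. -/
noncomputable def bichar (α β : DiscN) : ℂ := expTwoPi (pairN α β)

theorem chi_mk (x : dualN) :
    chi (Submodule.Quotient.mk x) = exp (Real.pi * I * (formN (x : AmbientN) x : ℚ)) := rfl

theorem bichar_mk (x y : dualN) : bichar (Submodule.Quotient.mk x) (Submodule.Quotient.mk y) =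
    exp (2 * Real.pi * I * (formN (x : AmbientN) y : ℚ)) := rfl

theorem qN_zero : qN 0 = 0 := by
  change qN (Submodule.Quotient.mk 0) = 0
  rw [qN_mk]
  simp

theorem chi_eq_ite [∀ α, Decidable (qN α = 0)] (α : DiscN) :
    chi α = if qN α = 0 then 1 else -1 := by
  obtain ⟨x, rfl⟩ := Submodule.Quotient.mk_surjective _ α
  obtain ⟨m, hm⟩ := formN_self_integral x.2
  rcases Int.even_or_odd m with he | ho
  · have h0 : qN (Submodule.Quotient.mk x) = 0 := by
      obtain ⟨k, rfl⟩ := he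
      rw [qN_mk, hm, AddCircle.coe_eq_zero_iff]
      exact ⟨k, by simp; ring⟩
    rw [if_pos h0, chi_mk, hm, Rat.cast_intCast, exp_pi_mul_I_mul_intCast, he.neg_one_zpow]
  · have h1 : chi (Submodule.Quotient.mk x) = -1 := by
      rw [chi_mk, hm, Rat.cast_intCast, exp_pi_mul_I_mul_intCast, ho.neg_one_zpow]
    have h0 : qN (Submodule.Quotient.mk x) ≠ 0 := fun h => by
      rw [chi, h, show (0 : AddCircle (2 : ℚ)) = ((0 : ℚ) : AddCircle (2 : ℚ)) by rfl, expPi_coe]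
        at h1
      norm_num at h1
    rw [if_neg h0, h1]

theorem chi_zero : chi 0 = 1 := by
  classical
  rw [chi_eq_ite, if_pos qN_zero]

theorem chi_mul_self (α : DiscN) : chi α * chi α = 1 := by
  classical
  rw [chi_eq_ite]
  split_ifs <;> norm_num

theorem chi_add (α β : DiscN) : chi (α + β) = chi α * chi β * bichar α β := by
  obtain ⟨x, rfl⟩ := Submodule.Quotient.mk_surjective _ α
  obtain ⟨y, rfl⟩ := Submodule.Quotient.mk_surjective _ β
  rw [← Submodule.Quotient.mk_add, chi_mk, chi_mk, chi_mk, bichar_mk, ← exp_add, ← exp_add]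
  congr 1
  simp only [Submodule.coe_add, map_add, LinearMap.add_apply, formN_comm (y : AmbientN) x]
  push_cast
  ring

theorem bichar_comm (α β : DiscN) : bichar α β = bichar β α := by
  obtain ⟨x, rfl⟩ := Submodule.Quotient.mk_surjective _ α
  obtain ⟨y, rfl⟩ := Submodule.Quotient.mk_surjective _ β
  rw [bichar_mk, bichar_mk, formN_comm]

theorem bichar_add_left (α β γ : DiscN) : bichar (α + β) γ = bichar α γ * bichar β γ := by
  obtain ⟨x, rfl⟩ := Submodule.Quotient.mk_surjective _ α
  obtain ⟨y, rfl⟩ := Submodule.Quotient.mk_surjective _ β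
  obtain ⟨z, rfl⟩ := Submodule.Quotient.mk_surjective _ γ
  rw [← Submodule.Quotient.mk_add, bichar_mk, bichar_mk, bichar_mk, ← exp_add]
  congr 1
  simp only [Submodule.coe_add, map_add, LinearMap.add_apply]
  push_cast
  ring

theorem bichar_add_right (α β γ : DiscN) : bichar α (β + γ) = bichar α β * bichar α γ := by
  rw [bichar_comm, bichar_add_left, bichar_comm β, bichar_comm γ]

theorem bichar_eq (α β : DiscN) : bichar α β = chi (α + β) * chi α * chi β := by
  rw [chi_add]
  linear_combination (-bichar α β) * (chi α * chi α * chi_mul_self β + chi_mul_self α)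

theorem bichar_mul_self (α β : DiscN) : bichar α β * bichar α β = 1 := by
  rw [bichar_eq]
  have h1 := chi_mul_self α
  have h2 := chi_mul_self β
  have h3 := chi_mul_self (α + β)
  linear_combination chi α * chi α * chi β * chi β * h3 + chi β * chi β * h1 + h2

theorem bichar_zero_left (β : DiscN) : bichar 0 β = 1 := by
  rw [bichar_eq, zero_add, chi_zero, mul_one, chi_mul_self]

/-- As `bichar` is a sign, it equals its inverse; the sign in the exponent is immaterial. -/
theorem expTwoPi_neg_pairN (α β : DiscN) : expTwoPi (-pairN α β) = bichar α β := by
  have h : expTwoPi (-pairN α β) * bichar α β = 1 := by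
    obtain ⟨x, rfl⟩ := Submodule.Quotient.mk_surjective _ α
    obtain ⟨y, rfl⟩ := Submodule.Quotient.mk_surjective _ β
    rw [bichar_mk, pairN_mk, ← AddCircle.coe_neg, expTwoPi_coe, ← exp_add]
    push_cast
    rw [← mul_add, neg_add_cancel, mul_zero, exp_zero]
  linear_combination bichar α β * h - expTwoPi (-pairN α β) * bichar_mul_self α β

theorem exists_bichar_ne_one {α : DiscN} (hα : α ≠ 0) : ∃ β, bichar α β ≠ 1 := by
  by_contra! h
  obtain ⟨x, rfl⟩ := Submodule.Quotient.mk_surjective _ α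
  refine hα ((Submodule.Quotient.mk_eq_zero _).mpr ?_)
  refine mem_latticeN_of_form_integral x.2 fun y hy => ?_
  have h1 := h (Submodule.Quotient.mk ⟨y, hy⟩)
  rw [bichar_mk, exp_eq_one_iff] at h1
  obtain ⟨n, hn⟩ := h1
  refine ⟨n, ?_⟩
  rw [mul_comm (n : ℂ)] at hn
  have := mul_left_cancel₀ two_pi_I_ne_zero hn
  exact_mod_cast this

/-- Orthogonality: translating the summation variable by `γ` multiplies the sum by `bichar α γ ≠ 1`.
-/
theorem sum_bichar_of_ne_zero {α : DiscN} (hα : α ≠ 0) : ∑ β, bichar α β = 0 := by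
  obtain ⟨γ, hγ⟩ := exists_bichar_ne_one hα
  have h : bichar α γ * ∑ β, bichar α β = ∑ β, bichar α β := by
    rw [Finset.mul_sum]
    simp only [← bichar_add_right]
    exact Equiv.sum_comp (Equiv.addLeft γ) (bichar α)
  have h2 : (bichar α γ - 1) * ∑ β, bichar α β = 0 := by rw [sub_mul, h, one_mul, sub_self]
  exact (mul_eq_zero.mp h2).resolve_left (sub_ne_zero.mpr hγ)

end EightPoints

namespace EightPoints

open Complex

/-! ### Representatives of the discriminant group -/

/-- Representatives of the classes of the dual of `D₄` modulo `D₄`. -/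
def repD4 (p : Fin 2 × Fin 2) : Fin 4 → ℚ :=
  fun i => (if i = 0 then ((p.1 : ℕ) : ℚ) else 0) + ((p.2 : ℕ) : ℚ) / 2

theorem isDualD4_repD4 (p : Fin 2 × Fin 2) : IsDualD4 (repD4 p) :=
  ⟨(p.2 : ℕ), fun i => if i = 0 then ((p.1 : ℕ) : ℤ) else 0, fun i => by
    by_cases h : i = 0 <;> simp [repD4, h]⟩

theorem exists_fin_two (m : ℤ) : ∃ (a : Fin 2) (k : ℤ), m = (a : ℕ) + 2 * k := by
  rcases Int.even_or_odd m with ⟨k, hk⟩ | ⟨k, hk⟩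
  · exact ⟨0, k, by simp; omega⟩
  · exact ⟨1, k, by simp; omega⟩

theorem exists_sub_repD4_mem {v : Fin 4 → ℚ} (hv : IsDualD4 v) :
    ∃ p, v - repD4 p ∈ latticeD4 := by
  obtain ⟨d, z, hz⟩ := hv
  obtain ⟨b, k, hk⟩ := exists_fin_two d
  obtain ⟨a, l, hl⟩ := exists_fin_two (∑ i, z i)
  -- With `d = b + 2k` and `∑ z = a + 2l`, the coordinates sum to `2l + 4k`, twice the witness `l +
  -- 2k`.
  refine ⟨(a, b), fun i => z i + k - if i = 0 then ((a : ℕ) : ℤ) else 0, fun i => ?_, l + 2 * k, ?_⟩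
  · rw [Pi.sub_apply, hz, hk, repD4]
    push_cast
    by_cases h : i = 0 <;> simp [h] <;> ring
  · rw [Fin.sum_univ_four] at hl ⊢
    simp
    linarith

theorem repD4_injective_mod {p p' : Fin 2 × Fin 2} (h : repD4 p - repD4 p' ∈ latticeD4) :
    p = p' := by
  obtain ⟨a, b⟩ := p
  obtain ⟨a', b'⟩ := p'
  obtain ⟨z, hz, s, hs⟩ := h
  have h0 := hz 0
  have h1 := hz 1
  have h2 := hz 2
  have h3 := hz 3
  simp only [Pi.sub_apply, repD4, if_true, Fin.reduceEq, if_false, zero_add] at h0 h1 h2 h3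
  rw [Fin.sum_univ_four] at hs
  have e0 : (2 * (a : ℕ) + (b : ℕ) - 2 * (a' : ℕ) - (b' : ℕ) : ℤ) = 2 * z 0 := by
    have : (2 * (a : ℕ) + (b : ℕ) - 2 * (a' : ℕ) - (b' : ℕ) : ℚ) = 2 * z 0 := by linarith
    exact_mod_cast this
  have e1 : ∀ i, ((b : ℕ) / 2 - (b' : ℕ) / 2 : ℚ) = z i →
      ((b : ℕ) - (b' : ℕ) : ℤ) = 2 * z i := fun i hi => by
    have : ((b : ℕ) - (b' : ℕ) : ℚ) = 2 * z i := by linarith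
    exact_mod_cast this
  have f1 := e1 1 h1
  have f2 := e1 2 h2
  have f3 := e1 3 h3
  ext <;> simp only <;> omega

/-- Representatives of the classes of the dual of `U(2)` modulo `U(2)`. -/
def repPlane (p : Fin 2 × Fin 2) : Fin 2 → ℚ := ![((p.1 : ℕ) : ℚ) / 2, ((p.2 : ℕ) : ℚ) / 2]

theorem exists_sub_repPlane_mem {v : Fin 2 → ℚ} (hv : ∀ i, ∃ z : ℤ, 2 * v i = z) :
    ∃ p, v - repPlane p ∈ intPlane := by
  choose z hz using hv
  obtain ⟨a, k, hk⟩ := exists_fin_two (z 0)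
  obtain ⟨b, l, hl⟩ := exists_fin_two (z 1)
  have h0 := hz 0
  have h1 := hz 1
  rw [hk] at h0
  rw [hl] at h1
  push_cast at h0 h1
  refine ⟨(a, b), ![k, l], fun i => ?_⟩
  fin_cases i
  · simp [repPlane]; linarith
  · simp [repPlane]; linarith

theorem repPlane_injective_mod {p p' : Fin 2 × Fin 2} (h : repPlane p - repPlane p' ∈ intPlane) :
    p = p' := by
  obtain ⟨a, b⟩ := p
  obtain ⟨a', b'⟩ := p'
  obtain ⟨z, hz⟩ := h
  have h0 := hz 0
  have h1 := hz 1
  simp only [Pi.sub_apply, repPlane, Matrix.cons_val_zero, Matrix.cons_val_one] at h0 h1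
  have e0 : ((a : ℕ) - (a' : ℕ) : ℤ) = 2 * z 0 := by
    have : ((a : ℕ) - (a' : ℕ) : ℚ) = 2 * z 0 := by linarith
    exact_mod_cast this
  have e1 : ((b : ℕ) - (b' : ℕ) : ℤ) = 2 * z 1 := by
    have : ((b : ℕ) - (b' : ℕ) : ℚ) = 2 * z 1 := by linarith
    exact_mod_cast this
  ext <;> simp only <;> omega

/-- Index set for the discriminant group, one factor for each of `U(2)`, `D₄`, `D₄`. -/
abbrev DiscIndex : Type := (Fin 2 × Fin 2) × (Fin 2 × Fin 2) × (Fin 2 × Fin 2)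

/-- Representatives in the dual lattice of the classes of the discriminant group. -/
def repN (p : DiscIndex) : dualN :=
  ⟨(0, repPlane p.1, repD4 p.2.1, repD4 p.2.2), mem_dualN_iff.mpr
    ⟨fun _ => ⟨0, by simp⟩, fun i => by
      fin_cases i
      · exact ⟨(p.1.1 : ℕ), by simp [repPlane]; ring⟩
      · exact ⟨(p.1.2 : ℕ), by simp [repPlane]; ring⟩,
    isDualD4_repD4 _, isDualD4_repD4 _⟩⟩

theorem repN_bijective :
    Function.Bijective fun p : DiscIndex => (Submodule.Quotient.mk (repN p) : DiscN) := by
  refine ⟨fun p p' h => ?_, fun α => ?_⟩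
  · obtain ⟨-, h1, h2, h3⟩ : ((repN p : AmbientN) - repN p') ∈ latticeN :=
      (Submodule.Quotient.eq (latticeN.submoduleOf dualN)).mp h
    exact Prod.ext (repPlane_injective_mod h1)
      (Prod.ext (repD4_injective_mod h2) (repD4_injective_mod h3))
  · obtain ⟨x, rfl⟩ := Submodule.Quotient.mk_surjective _ α
    obtain ⟨h1, h2, h3, h4⟩ := mem_dualN_iff.mp x.2
    obtain ⟨p, hp⟩ := exists_sub_repPlane_mem h2
    obtain ⟨q, hq⟩ := exists_sub_repD4_mem h3
    obtain ⟨r, hr⟩ := exists_sub_repD4_mem h4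
    choose z hz using h1
    refine ⟨(p, q, r), Eq.symm ((Submodule.Quotient.eq _).mpr ?_)⟩
    exact ⟨⟨z, fun i => by simp [repN, hz]⟩, hp, hq, hr⟩

theorem card_discN : Fintype.card DiscN = 64 := by
  rw [← Fintype.card_of_bijective repN_bijective]
  rfl

theorem chi_repN (p : DiscIndex) : chi (Submodule.Quotient.mk (repN p)) =
    (((-1) ^ ((p.1.1 * p.1.2 : ℕ) + (p.2.1.1 + p.2.1.1 * p.2.1.2 + p.2.1.2 : ℕ)
      + (p.2.2.1 + p.2.2.1 * p.2.2.2 + p.2.2.2 : ℕ)) : ℤ) : ℂ) := by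
  obtain ⟨⟨a, b⟩, ⟨c, d⟩, ⟨e, f⟩⟩ := p
  have hsq : ∀ n : Fin 2, ((n : ℕ) : ℚ) * ((n : ℕ) : ℚ) = (n : ℕ) := fun n => by
    fin_cases n <;> simp
  have hD : ∀ p : Fin 2 × Fin 2, ∑ i, repD4 p i * repD4 p i =
      ((p.1 + p.1 * p.2 + p.2 : ℕ) : ℚ) := fun p => by
    simp only [repD4, Fin.sum_univ_four, if_true, Fin.reduceEq, if_false, zero_add]
    push_cast
    linear_combination hsq p.1 + hsq p.2
  -- The `D₄` parts enter negatively; writing `-n` as `n - 2n` exhibits a natural exponent plus an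
  -- even correction.
  have hq : formN (repN ((a, b), (c, d), (e, f)) : AmbientN) (repN ((a, b), (c, d), (e, f))) =
      (((a * b + (c + c * d + d) + (e + e * f + f) : ℕ)
        - 2 * ((c + c * d + d : ℕ) + (e + e * f + f : ℕ)) : ℤ) : ℚ) := by
    rw [formN_apply]
    simp only [repN, hD, Pi.zero_apply, repPlane, Matrix.cons_val_zero, Matrix.cons_val_one]
    push_cast
    ring
  rw [chi_mk, hq, Rat.cast_intCast, exp_pi_mul_I_mul_intCast, zpow_sub₀ (by norm_num),
    zpow_mul, zpow_natCast]
  push_cast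
  norm_num

/-- The Gauss sum of the discriminant form. -/
theorem sum_chi : ∑ α, chi α = 8 := by
  rw [← repN_bijective.sum_comp]
  simp only [chi_repN]
  rw [← Int.cast_sum]
  -- The sum factors: `3 - 1 = 2` from `U(2)` and `1 - 3 = -2` from each `D₄`.
  have : ∑ p : DiscIndex, ((-1) ^ ((p.1.1 * p.1.2 : ℕ) + (p.2.1.1 + p.2.1.1 * p.2.1.2 + p.2.1.2 : ℕ)
      + (p.2.2.1 + p.2.2.1 * p.2.2.2 + p.2.2.2 : ℕ)) : ℤ) = 8 := by decide +kernel
  rw [this]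
  norm_num

theorem sum_bichar [DecidableEq DiscN] (α : DiscN) :
    ∑ β, bichar α β = if α = 0 then 64 else 0 := by
  split_ifs with h
  · simp [h, bichar_zero_left, card_discN]
  · exact sum_bichar_of_ne_zero h

/-- Completing the square, `bichar α β * chi β = chi α * chi (α + β)`, reduces this to the Gauss
sum. -/
theorem sum_bichar_mul_chi (α : DiscN) : ∑ β, bichar α β * chi β = 8 * chi α := by
  have h : ∀ β, bichar α β * chi β = chi α * chi (α + β) := fun β => by
    rw [chi_add]
    linear_combination (-bichar α β * chi β) * chi_mul_self α
  simp only [h]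
  have h' : ∑ β, chi (α + β) = ∑ β, chi β := Equiv.sum_comp (Equiv.addLeft α) chi
  rw [← Finset.mul_sum, h', sum_chi, mul_comm]

/-! ### The transformation equations indexed by the discriminant group -/

theorem byType_eq [DecidableEq DiscN] (f00 f0 f1 : ℂ → ℂ) (τ : ℂ) (β : DiscN) :
    byType f00 f0 f1 τ β = (f00 τ - f0 τ) * (if β = 0 then 1 else 0) + (f0 τ + f1 τ) / 2
      + (f0 τ - f1 τ) / 2 * chi β := by
  classical
  rw [chi_eq_ite]
  by_cases h : β = 0
  · simp only [byType, h, qN_zero, if_true]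
    ring
  · by_cases h' : qN β = 0
    · simp only [byType, h, h', if_true, if_false]
      ring
    · simp only [byType, h, h', if_false]
      ring

theorem sum_bichar_mul_byType [DecidableEq DiscN] (f00 f0 f1 : ℂ → ℂ) (τ : ℂ) (α : DiscN) :
    ∑ β, bichar α β * byType f00 f0 f1 τ β = (f00 τ - f0 τ)
      + (f0 τ + f1 τ) / 2 * (if α = 0 then 64 else 0) + (f0 τ - f1 τ) / 2 * (8 * chi α) := by
  rw [← sum_bichar, ← sum_bichar_mul_chi, Finset.mul_sum, Finset.mul_sum]
  have h1 : f00 τ - f0 τ = ∑ β, (f00 τ - f0 τ) * (bichar α β * if β = 0 then 1 else 0) := by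
    simp [bichar_comm α, bichar_zero_left]
  rw [h1, ← Finset.sum_add_distrib, ← Finset.sum_add_distrib]
  refine Finset.sum_congr rfl fun β _ => ?_
  rw [byType_eq]
  ring

theorem satisfiesGeneratorEquations {f00 f0 f1 : ℂ → ℂ}
    (h : SolvesTransformationEquations f00 f0 f1) :
    SatisfiesGeneratorEquations (byType f00 f0 f1) where
  eq_T α τ hτ := by
    classical
    change _ = chi α * _
    rw [chi_eq_ite]
    by_cases h0 : α = 0
    · simp only [byType, h0, qN_zero, if_true, h.f00_T τ hτ, one_mul]
    · by_cases h' : qN α = 0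
      · simp only [byType, h0, h', if_true, if_false, h.f0_T τ hτ, one_mul]
      · simp only [byType, h0, h', if_false, h.f1_T τ hτ, neg_one_mul]
  eq_S α τ hτ := by
    classical
    simp only [expTwoPi_neg_pairN]
    rw [sum_bichar_mul_byType, chi_eq_ite]
    by_cases h0 : α = 0
    · simp only [byType, h0, qN_zero, if_true, h.f00_S τ hτ]
      ring
    · by_cases h' : qN α = 0
      · simp only [byType, h0, h', if_true, if_false, h.f0_S τ hτ]
        ring
      · simp only [byType, h0, h', if_false, h.f1_S τ hτ]
        ring

end EightPoints

namespace EightPoints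

open Complex MatrixGroups

/-! ### The Weil representation -/

/-- The elements of `SL(2, 𝔽₂)`, numbered in the order `1, S, T, ST, TS, STS`. -/
def indexSL2 (a b c d : ZMod 2) : Fin 6 :=
  if (a, b, c, d) = (1, 0, 0, 1) then 0 else if (a, b, c, d) = (0, 1, 1, 0) then 1
  else if (a, b, c, d) = (1, 1, 0, 1) then 2 else if (a, b, c, d) = (0, 1, 1, 1) then 3
  else if (a, b, c, d) = (1, 1, 1, 0) then 4 else 5

theorem indexSL2_S_mul : ∀ a b c d : ZMod 2, a * d - b * c = 1 →
    indexSL2 (-c) (-d) a b = ![1, 0, 3, 2, 5, 4] (indexSL2 a b c d) := by decide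

theorem indexSL2_T_mul : ∀ a b c d : ZMod 2, a * d - b * c = 1 →
    indexSL2 (a + c) (b + d) c d = ![2, 4, 0, 5, 1, 3] (indexSL2 a b c d) := by decide

/-- The `A` for which `g (A * B) = g A * g B` holds for all `B` form a subgroup, here containing
both generators. -/
theorem map_mul_of_map_generator_mul {G : Type*} [Group G] {g : SL(2, ℤ) → G} (h1 : g 1 = 1)
    (hS : ∀ A, g (ModularGroup.S * A) = g ModularGroup.S * g A)
    (hT : ∀ A, g (ModularGroup.T * A) = g ModularGroup.T * g A) (A B : SL(2, ℤ)) :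
    g (A * B) = g A * g B := by
  have hA : A ∈ Subgroup.closure {ModularGroup.S, ModularGroup.T} := by
    simp [SpecialLinearGroup.SL2Z_generators]
  induction hA using Subgroup.closure_induction generalizing B with
  | mem x hx =>
    rcases hx with rfl | rfl
    · exact hS B
    · exact hT B
  | one => simp [h1]
  | mul x y _ _ hx hy => rw [mul_assoc, hx, hy, hx, mul_assoc]
  | inv x _ hx =>
    have e1 := hx x⁻¹
    rw [mul_inv_cancel, h1] at e1
    have e2 := hx (x⁻¹ * B)
    rw [mul_inv_cancel_left] at e2
    rw [e2, ← mul_assoc, mul_eq_one_iff_eq_inv.mp (mul_eq_one_comm.mp e1.symm), inv_mul_cancel,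
      one_mul]

/-- Elements `s`, `t` of a group with `s² = t² = 1`, `sts = tst` are the images of `S`, `T` under
a homomorphism from `SL(2, ℤ)`, which factors through `SL(2, 𝔽₂)`. -/
theorem exists_monoidHom_SL2 {G : Type*} [Group G] {s t : G} (hs : s * s = 1) (ht : t * t = 1)
    (hst : s * t * s = t * s * t) :
    ∃ f : SL(2, ℤ) →* G, f ModularGroup.S = s ∧ f ModularGroup.T = t := by
  let w : Fin 6 → G := ![1, s, t, s * t, t * s, s * t * s]
  let g : SL(2, ℤ) → G := fun A => w (indexSL2 (A 0 0 : ℤ) (A 0 1 : ℤ) (A 1 0 : ℤ) (A 1 1 : ℤ))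
  have hdet : ∀ A : SL(2, ℤ), ((A 0 0 : ℤ) : ZMod 2) * ((A 1 1 : ℤ) : ZMod 2)
      - ((A 0 1 : ℤ) : ZMod 2) * ((A 1 0 : ℤ) : ZMod 2) = 1 := fun A => by
    have h := A.det_coe
    rw [Matrix.det_fin_two] at h
    exact_mod_cast congrArg (Int.cast : ℤ → ZMod 2) h
  -- The permutations in `wS` and `wT` are left multiplication by `S` and `T` on the six words; the
  -- three relations are what make `w` compatible with them.
  have wS : ∀ i, w (![1, 0, 3, 2, 5, 4] i) = s * w i := by
    intro i
    fin_cases i <;> simp [w, ← mul_assoc, hs]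
  have wT : ∀ i, w (![2, 4, 0, 5, 1, 3] i) = t * w i := by
    intro i
    fin_cases i <;> simp [w, ← mul_assoc, ht, hst]
  have g1 : g 1 = 1 := by
    have : indexSL2 1 0 0 1 = 0 := by decide
    simp [g, this, w]
  have gS : g ModularGroup.S = s := by
    have : indexSL2 0 1 1 0 = 1 := by decide
    simp [g, this, w, ModularGroup.S]
  have gT : g ModularGroup.T = t := by
    have : indexSL2 1 1 0 1 = 2 := by decide
    simp [g, this, w, ModularGroup.T]
  refine ⟨⟨⟨g, g1⟩, map_mul_of_map_generator_mul g1 (fun A => ?_) fun A => ?_⟩, gS, gT⟩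
  · change g (ModularGroup.S * A) = g ModularGroup.S * g A
    rw [gS]
    simp only [g]
    rw [← wS, ← indexSL2_S_mul _ _ _ _ (hdet A)]
    simp [Matrix.SpecialLinearGroup.coe_mul, ModularGroup.coe_S, Matrix.mul_apply,
      Fin.sum_univ_two]
  · change g (ModularGroup.T * A) = g ModularGroup.T * g A
    rw [gT]
    simp only [g]
    rw [← wT, ← indexSL2_T_mul _ _ _ _ (hdet A)]
    simp [Matrix.SpecialLinearGroup.coe_mul, ModularGroup.coe_T, Matrix.mul_apply,
      Fin.sum_univ_two]

/-- The action of `S` on `ℂ[A_N]`. -/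
noncomputable def weilS : Module.End ℂ (DiscN → ℂ) where
  toFun v α := 1 / 8 * ∑ β, bichar α β * v β
  map_add' v w := by
    ext α
    simp only [Pi.add_apply, mul_add, Finset.sum_add_distrib]
  map_smul' c v := by
    ext α
    simp only [Pi.smul_apply, smul_eq_mul, RingHom.id_apply, Finset.mul_sum]
    exact Finset.sum_congr rfl fun β _ => by ring

/-- The action of `T` on `ℂ[A_N]`. -/
noncomputable def weilT : Module.End ℂ (DiscN → ℂ) where
  toFun v α := chi α * v α
  map_add' v w := by
    ext α
    simp only [Pi.add_apply, mul_add]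
  map_smul' c v := by
    ext α
    simp only [Pi.smul_apply, smul_eq_mul, RingHom.id_apply]
    ring

theorem weilS_apply (v : DiscN → ℂ) (α : DiscN) :
    weilS v α = 1 / 8 * ∑ β, bichar α β * v β := rfl

theorem weilT_apply (v : DiscN → ℂ) (α : DiscN) : weilT v α = chi α * v α := rfl

/-- A pairing that is nondegenerate and takes only the values `±1` forces exponent 2. -/
theorem add_self_eq_zero (α : DiscN) : α + α = 0 := by
  by_contra h
  obtain ⟨β, hβ⟩ := exists_bichar_ne_one h
  exact hβ (by rw [bichar_add_left, bichar_mul_self])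

/-- By orthogonality `S²` sends `v` to `α ↦ v (-α)`, and `-α = α`. -/
theorem weilS_mul_self : weilS * weilS = 1 := by
  classical
  refine LinearMap.ext fun v => funext fun α => ?_
  have h : ∀ β, bichar α β * (1 / 8 * ∑ γ, bichar β γ * v γ) =
      ∑ γ, 1 / 8 * (bichar (α + γ) β * v γ) := fun β => by
    rw [Finset.mul_sum, Finset.mul_sum]
    refine Finset.sum_congr rfl fun γ _ => ?_
    rw [bichar_add_left, bichar_comm γ β]
    ring
  have h0 : ∀ γ, α + γ = 0 ↔ γ = α := fun γ => by
    rw [← add_self_eq_zero α, add_right_inj]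
  rw [Module.End.mul_apply, Module.End.one_apply, weilS_apply]
  simp only [weilS_apply, h]
  rw [Finset.sum_comm]
  simp only [← Finset.mul_sum, ← Finset.sum_mul, sum_bichar, h0, ite_mul, zero_mul,
    Finset.sum_ite_eq', Finset.mem_univ, if_true]
  ring

theorem weilT_mul_self : weilT * weilT = 1 := by
  refine LinearMap.ext fun v => funext fun α => ?_
  rw [Module.End.mul_apply, Module.End.one_apply, weilT_apply, weilT_apply, ← mul_assoc,
    chi_mul_self, one_mul]

/-- The kernel of `STS` is a Gauss sum in the middle variable, equal to `chi (α + γ) / 8`; expanding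
`chi (α + γ)` gives the kernel of `TST`. -/
theorem weilS_mul_weilT_mul_weilS : weilS * weilT * weilS = weilT * weilS * weilT := by
  refine LinearMap.ext fun v => funext fun α => ?_
  have h : ∀ β, bichar α β * (chi β * (1 / 8 * ∑ γ, bichar β γ * v γ)) =
      ∑ γ, 1 / 8 * (bichar (α + γ) β * chi β * v γ) := fun β => by
    rw [Finset.mul_sum, Finset.mul_sum, Finset.mul_sum]
    refine Finset.sum_congr rfl fun γ _ => ?_
    rw [bichar_add_left, bichar_comm γ β]
    ring
  simp only [Module.End.mul_apply, weilS_apply, weilT_apply, h]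
  rw [Finset.sum_comm]
  simp only [← Finset.mul_sum, ← Finset.sum_mul, sum_bichar_mul_chi]
  rw [Finset.mul_sum, Finset.mul_sum, Finset.mul_sum, Finset.mul_sum]
  refine Finset.sum_congr rfl fun γ _ => ?_
  rw [chi_add]
  ring

theorem exists_weilRepresentation :
    ∃ ρ : Representation ℂ SL(2, ℤ) (DiscN → ℂ),
      ρ ModularGroup.S = weilS ∧ ρ ModularGroup.T = weilT := by
  obtain ⟨f, hS, hT⟩ := exists_monoidHom_SL2
    (s := (⟨weilS, weilS, weilS_mul_self, weilS_mul_self⟩ : (Module.End ℂ (DiscN → ℂ))ˣ))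
    (t := ⟨weilT, weilT, weilT_mul_self, weilT_mul_self⟩) (Units.ext weilS_mul_self)
    (Units.ext weilT_mul_self) (Units.ext weilS_mul_weilT_mul_weilS)
  refine ⟨(Units.coeHom _).comp f, ?_, ?_⟩
  · rw [MonoidHom.comp_apply, hS]; rfl
  · rw [MonoidHom.comp_apply, hT]; rfl

theorem basisVec_apply [DecidableEq DiscN] (α β : DiscN) :
    basisVec α β = if β = α then 1 else 0 := by
  by_cases h : β = α
  · subst h
    simp [basisVec]
  · simp [basisVec, h]

theorem isWeilRepresentation_of_eq {ρ : Representation ℂ SL(2, ℤ) (DiscN → ℂ)}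
    (hS : ρ ModularGroup.S = weilS) (hT : ρ ModularGroup.T = weilT) :
    IsWeilRepresentation ρ where
  map_T α := by
    classical
    ext β
    rw [hT, weilT_apply, Pi.smul_apply, basisVec_apply, smul_eq_mul, ← chi]
    split_ifs with h
    · rw [h]
    · simp
  map_S α := by
    classical
    ext β
    rw [hS, weilS_apply, Pi.smul_apply, Finset.sum_apply, smul_eq_mul]
    simp [basisVec_apply, bichar]

/-! ### Vector-valued modularity -/

theorem coe_smul_eq (γ : SL(2, ℤ)) (τ : UpperHalfPlane) : ((γ • τ : UpperHalfPlane) : ℂ) =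
    ((γ 0 0 : ℤ) * τ + (γ 0 1 : ℤ)) / ((γ 1 0 : ℤ) * τ + (γ 1 1 : ℤ)) := by
  rw [UpperHalfPlane.specialLinearGroup_apply]
  simp

theorem cocycle_mul (γ δ : SL(2, ℤ)) (τ : UpperHalfPlane) :
    (((γ * δ) 1 0 : ℤ) : ℂ) * τ + ((γ * δ) 1 1 : ℤ) =
      (((γ 1 0 : ℤ) : ℂ) * (δ • τ : UpperHalfPlane) + (γ 1 1 : ℤ)) *
        (((δ 1 0 : ℤ) : ℂ) * τ + (δ 1 1 : ℤ)) := by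
  have h : ((δ 1 0 : ℤ) : ℂ) * τ + (δ 1 1 : ℤ) ≠ 0 := by
    rw [← ModularGroup.denom_apply]
    exact UpperHalfPlane.denom_ne_zero _ τ
  rw [coe_smul_eq, add_mul, mul_assoc, div_mul_cancel₀ _ h]
  simp only [Matrix.SpecialLinearGroup.coe_mul, Matrix.mul_apply, Fin.sum_univ_two]
  push_cast
  ring

theorem isVectorValuedModularForm_of_generators {k : ℤ}
    {ρ : Representation ℂ SL(2, ℤ) (DiscN → ℂ)} {F : ℂ → DiscN → ℂ}
    (holo : ∀ α, DifferentiableOn ℂ (fun τ => F τ α) {τ : ℂ | 0 < τ.im})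
    (hS : ∀ τ : ℂ, 0 < τ.im → F (-1 / τ) = τ ^ k • ρ ModularGroup.S (F τ))
    (hT : ∀ τ : ℂ, 0 < τ.im → F (τ + 1) = ρ ModularGroup.T (F τ)) :
    IsVectorValuedModularForm k ρ F where
  holo := holo
  modular γ τ hτ := by
    -- The induction needs all `τ` at once: products and inverses use the equation at `δ • τ` and
    -- `γ⁻¹ • τ`.
    suffices h : ∀ τ : UpperHalfPlane, F ((γ • τ : UpperHalfPlane) : ℂ) =
        (((γ 1 0 : ℤ) : ℂ) * τ + (γ 1 1 : ℤ)) ^ k • ρ γ (F τ) by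
      have := h ⟨τ, hτ⟩
      rwa [coe_smul_eq] at this
    have hγ : γ ∈ Subgroup.closure {ModularGroup.S, ModularGroup.T} := by
      simp [SpecialLinearGroup.SL2Z_generators]
    induction hγ using Subgroup.closure_induction with
    | mem γ hγ =>
      intro τ
      rw [coe_smul_eq]
      rcases hγ with rfl | rfl
      · simpa [ModularGroup.S] using hS τ τ.2
      · simpa [ModularGroup.T] using hT τ τ.2
    | one => intro τ; simp
    | mul γ δ _ _ hγ hδ =>
      intro τ
      rw [mul_smul, hγ, hδ, cocycle_mul, mul_zpow, map_mul, map_smul, smul_smul,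
        Module.End.mul_apply]
    | inv γ _ hγ =>
      intro τ
      have h1 := hγ (γ⁻¹ • τ)
      have h2 := cocycle_mul γ γ⁻¹ τ
      rw [smul_inv_smul] at h1
      rw [mul_inv_cancel] at h2
      simp only [Matrix.SpecialLinearGroup.coe_one, ne_eq, one_ne_zero, not_false_eq_true,
        Matrix.one_apply_ne, Matrix.one_apply_eq, Int.cast_zero, Int.cast_one, zero_mul,
        zero_add] at h2
      rw [h1, map_smul, ← Module.End.mul_apply, ← map_mul, inv_mul_cancel, map_one,
        Module.End.one_apply, smul_smul, ← mul_zpow, mul_comm, ← h2, one_zpow, one_smul]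

theorem differentiableOn_byType {f00 f0 f1 : ℂ → ℂ} {s : Set ℂ} (h00 : DifferentiableOn ℂ f00 s)
    (h0 : DifferentiableOn ℂ f0 s) (h1 : DifferentiableOn ℂ f1 s) (α : DiscN) :
    DifferentiableOn ℂ (fun τ => byType f00 f0 f1 τ α) s := by
  unfold byType
  split_ifs <;> assumption

theorem isVectorValuedModularForm_of_generatorEquations
    {ρ : Representation ℂ SL(2, ℤ) (DiscN → ℂ)} (hρS : ρ ModularGroup.S = weilS)
    (hρT : ρ ModularGroup.T = weilT) {F : ℂ → DiscN → ℂ}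
    (holo : ∀ α, DifferentiableOn ℂ (fun τ => F τ α) {τ : ℂ | 0 < τ.im})
    (hF : SatisfiesGeneratorEquations F) : IsVectorValuedModularForm (-4) ρ F := by
  refine isVectorValuedModularForm_of_generators holo (fun τ hτ => ?_) fun τ hτ => ?_
  · ext α
    rw [hF.eq_S α τ hτ, hρS, Pi.smul_apply, weilS_apply, smul_eq_mul]
    simp only [expTwoPi_neg_pairN]
    ring
  · ext α
    rw [hF.eq_T α τ hτ, hρT, weilT_apply, chi]

end EightPoints

theorem lemma6p2 :
    EightPoints.SolvesTransformationEquations EightPoints.h00 EightPoints.h0 EightPoints.h1 ∧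
    (∃ a : ℕ → ℂ, EightPoints.HasQExpansion EightPoints.h00 0 a ∧
      a 0 = 56 ∧ a 1 = 896 ∧ a 2 = 8064) ∧
    (∃ a : ℕ → ℂ, EightPoints.HasQExpansion EightPoints.h0 0 a ∧
      a 0 = -8 ∧ a 1 = -128 ∧ a 2 = -1152) ∧
    (∃ a : ℕ → ℂ, EightPoints.HasQExpansion EightPoints.h1 (-(1 / 2)) a ∧
      a 0 = 1 ∧ a 1 = 36 ∧ a 2 = 402) ∧
    EightPoints.SatisfiesGeneratorEquations
      (EightPoints.byType EightPoints.h00 EightPoints.h0 EightPoints.h1) ∧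
    (∃ ρ : Representation ℂ (Matrix.SpecialLinearGroup (Fin 2) ℤ) (EightPoints.DiscN → ℂ),
      EightPoints.IsWeilRepresentation ρ ∧
      EightPoints.IsVectorValuedModularForm (-4) ρ
        (EightPoints.byType EightPoints.h00 EightPoints.h0 EightPoints.h1)) := by
  have hG := EightPoints.satisfiesGeneratorEquations EightPoints.solvesTransformationEquations
  obtain ⟨ρ, hS, hT⟩ := EightPoints.exists_weilRepresentation
  exact ⟨EightPoints.solvesTransformationEquations, EightPoints.h00_hasQExpansion,
    EightPoints.h0_hasQExpansion, EightPoints.h1_hasQExpansion, hG, ρ,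
    EightPoints.isWeilRepresentation_of_eq hS hT,
    EightPoints.isVectorValuedModularForm_of_generatorEquations hS hT
      (EightPoints.differentiableOn_byType EightPoints.differentiableOn_h00
        EightPoints.differentiableOn_h0 EightPoints.differentiableOn_h1) hG⟩
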